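/- Let $S$ be a non-empty set of prime numbers, let $A=\mathbb{Z}[1/S]\subseteq\mathbb{Q}$ be the ring generated by the inverses of the elements of $S$, and choose $p\in S$. Let $\Gamma_S$ be the group (under composition) of all homeomorphisms $h$ of $\mathbb{R}$ for which the line can be decomposed into finitely many intervals on each of which $h$ is given by $x\mapsto\frac{ax+b}{cx+d}$ for some $\begin{pmatrix}a&b\\c&d\end{pmatrix}\in\mathrm{SL}_2(A)$, and let $H(A)$ be the subgroup of those $h$ for which the breakpoints can be taken among the fixed points in $\mathbb{P}^1_{\mathbb{R}}=\mathbb{R}\cup\{\infty\}$ of hyperbolic elements of $\mathrm{SL}_2(A)$ (those with $\mathrm{trace}^2>4$). Let $K$ be the space of measurable maps $f\colon\mathbb{P}^1_{\mathbb{R}}\to\mathrm{Prob}(\mathbb{P}^1_{\mathbb{Q}_p})$, where $\mathrm{Prob}$ denotes Borel probability measures with the weak-* topology and where two maps are identified if they agree outside a Lebesgue null-set. Endow $K$ with the weak-* topology as a subset of the dual of $L^1(\mathbb{P}^1_{\mathbb{R}},C(\mathbb{P}^1_{\mathbb{Q}_p}))$, and let $\Gamma_S$ act on $K$ by $$(h.f)(x)=h|_{h^{-1}x}\bigl(f(h^{-1}x)\bigr)\quad\text{for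 a.e. }x,$$ where $h|_y\in\mathrm{PSL}_2(A)$ is the projective transformation with which $h$ coincides near $y$, acting on $\mathrm{Prob}(\mathbb{P}^1_{\mathbb{Q}_p})$ by push-forward. Then $\Gamma_S=H(A)$; the space $K$ is a convex compact $\Gamma_S$-space (that is, it is realised as a compact convex set on which $\Gamma_S$ acts by affine homeomorphisms); and $\Gamma_S$ has no fixed point in $K$. In particular $\Gamma_S$ is non-amenable, i.e. it is not true that every non-empty convex compact $\Gamma_S$-space (realised in a locally convex Hausdorff topological vector space) has a fixed point. -/

import Mathlib

open MeasureTheory Filter Topology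
open Matrix (SpecialLinearGroup det_fin_two)

noncomputable section

namespace PiecewiseProjective

/-! ### Projective lines

The projective line over a topological field `K` is `OnePoint K = K ∪ {∞}`, where `x` stands for
`[x : 1]` and `∞` for `[1 : 0]`.  It carries the topology of the one-point compactification (which
is the usual one since `K` will be `ℝ` or `ℚ_[p]`) and the Borel σ-algebra. -/

instance instMeasurableSpaceOnePoint {X : Type*} [TopologicalSpace X] :
    MeasurableSpace (OnePoint X) := borel _

instance instBorelSpaceOnePoint {X : Type*} [TopologicalSpace X] : BorelSpace (OnePoint X) := ⟨rfl⟩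

/-- The action of `SL₂(A)` on the projective line over a field `K` in which `A` maps, by
`x ↦ (a x + b) / (c x + d)`. -/
def proj (K : Type*) {A : Type*} [CommRing A] [Field K] [Algebra A K]
    (g : SpecialLinearGroup (Fin 2) A) (x : OnePoint K) : OnePoint K :=
  letI : DecidableEq K := Classical.decEq K
  SpecialLinearGroup.mapGL K g • x

section proj

variable {K : Type*} {A : Type*} [CommRing A] [Field K] [Algebra A K]

theorem proj_one (x : OnePoint K) : proj K (1 : SpecialLinearGroup (Fin 2) A) x = x := by
  simp [proj]

theorem proj_mul (g h : SpecialLinearGroup (Fin 2) A) (x : OnePoint K) :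
    proj K (g * h) x = proj K g (proj K h x) := by
  simp [proj, mul_smul]

theorem proj_inv_proj (g : SpecialLinearGroup (Fin 2) A) (x : OnePoint K) :
    proj K g⁻¹ (proj K g x) = x := by
  rw [← proj_mul, inv_mul_cancel, proj_one]

theorem proj_proj_inv (g : SpecialLinearGroup (Fin 2) A) (x : OnePoint K) :
    proj K g (proj K g⁻¹ x) = x := by
  rw [← proj_mul, mul_inv_cancel, proj_one]

open Classical in
theorem proj_coe (g : SpecialLinearGroup (Fin 2) A) (x : K) :
    proj K g (x : OnePoint K) =
      if algebraMap A K (g 1 0) * x + algebraMap A K (g 1 1) = 0 then OnePoint.infty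
      else (((algebraMap A K (g 0 0) * x + algebraMap A K (g 0 1)) /
        (algebraMap A K (g 1 0) * x + algebraMap A K (g 1 1)) : K) : OnePoint K) := by
  rw [proj, OnePoint.smul_some_eq_ite]
  rfl

end proj

theorem measurable_of_finite {X Y : Type*} [TopologicalSpace X] [MeasurableSpace X] [BorelSpace X]
    [T1Space X] [TopologicalSpace Y] [MeasurableSpace Y] [BorelSpace Y] {f : X → Y} {s : Set X}
    (hs : s.Finite) (hf : ∀ x ∉ s, ContinuousAt f x) : Measurable f := by
  refine measurable_of_isOpen fun U hU ↦ ?_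
  have : f ⁻¹' U = interior (f ⁻¹' U) ∪ (f ⁻¹' U ∩ s) := by
    ext x
    constructor
    · intro hx
      by_cases h : x ∈ s
      · exact Or.inr ⟨hx, h⟩
      · exact Or.inl (mem_interior_iff_mem_nhds.2 ((hf x h) (hU.mem_nhds hx)))
    · rintro (hx | hx)
      · exact interior_subset hx
      · exact hx.1
  rw [this]
  exact isOpen_interior.measurableSet.union (hs.subset Set.inter_subset_right).measurableSet

theorem measurable_proj {K : Type*} {A : Type*} [CommRing A] [NormedField K] [Algebra A K]
    (g : SpecialLinearGroup (Fin 2) A) : Measurable (proj K g) := by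
  classical
  set c := algebraMap A K (g 1 0)
  set d := algebraMap A K (g 1 1)
  refine measurable_of_finite (s := {OnePoint.infty, ((-d / c : K) : OnePoint K)})
    (by simp) fun x hx ↦ ?_
  induction x using OnePoint.rec with
  | infty => simp at hx
  | coe x =>
    have hdet : algebraMap A K (g 0 0) * d - algebraMap A K (g 0 1) * c = 1 := by
      have := g.det_coe
      rw [det_fin_two] at this
      simpa [c, d] using congrArg (algebraMap A K) this
    have hx0 : c * x + d ≠ 0 := by
      intro h0
      by_cases hc : c = 0
      · have hd : d = 0 := by simpa [hc] using h0
        simp [hc, hd] at hdet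
      · apply hx
        right
        simp only [Set.mem_singleton_iff, OnePoint.coe_eq_coe]
        rw [eq_div_iff hc]
        linear_combination h0
    rw [OnePoint.continuousAt_coe]
    have hev : (proj K g ∘ ((↑) : K → OnePoint K)) =ᶠ[𝓝 x]
        fun y ↦ (((algebraMap A K (g 0 0) * y + algebraMap A K (g 0 1)) / (c * y + d) : K) :
          OnePoint K) := by
      have : ∀ᶠ y in 𝓝 x, c * y + d ≠ 0 :=
        (by fun_prop : Continuous fun y : K ↦ c * y + d).continuousAt.eventually_ne hx0
      filter_upwards [this] with y hy
      rw [Function.comp_apply, proj_coe, if_neg hy]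
    refine ContinuousAt.congr ?_ hev.symm
    refine OnePoint.continuous_coe.continuousAt.comp ?_
    exact ContinuousAt.div (by fun_prop) (by fun_prop) hx0

/-- The Lebesgue measure on `P¹(ℝ)`; it gives mass `0` to the point `∞`.  Its null-sets are the
null-sets of `P¹(ℝ)`. -/
def lebesgue : Measure (OnePoint ℝ) := Measure.map ((↑) : ℝ → OnePoint ℝ) volume

/-! ### Groups of piecewise-projective homeomorphisms of the line -/

/-- The homeomorphism `h` of the line is piecewise-`SL₂(A)` with breakpoints in `B`: there is a
finite set `F` of points of `B` such that, on every interval with no point of `F` in its interior,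
`h` is given by some `g ∈ SL₂(A)` (in particular `g` has no singularity there, `h` being
real-valued). -/
def IsPiecewise (A : Subring ℚ) (B : Set (OnePoint ℝ)) (h : ℝ ≃ₜ ℝ) : Prop :=
  ∃ F : Finset ℝ, (∀ b ∈ F, (b : OnePoint ℝ) ∈ B) ∧
    ∀ I : Set ℝ, I.OrdConnected → Disjoint (interior I) (F : Set ℝ) →
      ∃ g : SpecialLinearGroup (Fin 2) A, ∀ x ∈ I, ((h x : ℝ) : OnePoint ℝ) = proj ℝ g x

theorem IsPiecewise.one (A : Subring ℚ) (B : Set (OnePoint ℝ)) : IsPiecewise A B 1 :=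
  ⟨∅, by simp, fun I _ _ ↦ ⟨1, fun x _ ↦ by simp [proj_one]⟩⟩

theorem image_ordConnected (h : ℝ ≃ₜ ℝ) {I : Set ℝ} (hI : I.OrdConnected) :
    (h '' I).OrdConnected :=
  (hI.isPreconnected.image h h.continuous.continuousOn).ordConnected

theorem IsPiecewise.mul {A : Subring ℚ} {B : Set (OnePoint ℝ)}
    (hB : ∀ g : SpecialLinearGroup (Fin 2) A, ∀ x ∈ B, proj ℝ g x ∈ B) {h k : ℝ ≃ₜ ℝ}
    (hh : IsPiecewise A B h) (hk : IsPiecewise A B k) : IsPiecewise A B (h * k) := by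
  obtain ⟨F, hF, hFg⟩ := hh
  obtain ⟨F', hF', hFg'⟩ := hk
  classical
  refine ⟨F' ∪ F.image k.symm, ?_, ?_⟩
  · intro b hb
    rcases Finset.mem_union.1 hb with hb | hb
    · exact hF' b hb
    · obtain ⟨c, hc, rfl⟩ := Finset.mem_image.1 hb
      obtain ⟨g, hg⟩ := hFg' {k.symm c} Set.ordConnected_singleton (by simp)
      have h1 := hg _ rfl
      rw [Homeomorph.apply_symm_apply] at h1
      have h2 := hB g⁻¹ _ (hF c hc)
      rwa [h1, proj_inv_proj] at h2
  · intro I hI hd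
    rw [Finset.coe_union, Set.disjoint_union_right] at hd
    obtain ⟨g', hg'⟩ := hFg' I hI hd.1
    obtain ⟨g, hg⟩ := hFg (k '' I) (image_ordConnected k hI) (by
      rw [← k.image_interior, Set.disjoint_left]
      rintro _ ⟨x, hx, rfl⟩ hxF
      refine Set.disjoint_left.1 hd.2 hx ?_
      simp only [Finset.coe_image, Set.mem_image]
      exact ⟨k x, hxF, by simp⟩)
    refine ⟨g * g', fun x hx ↦ ?_⟩
    rw [proj_mul, ← hg' x hx, ← hg (k x) ⟨x, hx, rfl⟩]
    rfl

theorem IsPiecewise.inv {A : Subring ℚ} {B : Set (OnePoint ℝ)}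
    (hB : ∀ g : SpecialLinearGroup (Fin 2) A, ∀ x ∈ B, proj ℝ g x ∈ B) {h : ℝ ≃ₜ ℝ}
    (hh : IsPiecewise A B h) : IsPiecewise A B h⁻¹ := by
  obtain ⟨F, hF, hFg⟩ := hh
  classical
  refine ⟨F.image h, ?_, ?_⟩
  · intro b hb
    obtain ⟨c, hc, rfl⟩ := Finset.mem_image.1 hb
    obtain ⟨g, hg⟩ := hFg {c} Set.ordConnected_singleton (by simp)
    rw [hg c rfl]
    exact hB g _ (hF c hc)
  · intro I hI hd
    obtain ⟨g, hg⟩ := hFg (h.symm '' I) (image_ordConnected h.symm hI) (by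
      rw [← h.symm.image_interior, Set.disjoint_left]
      rintro _ ⟨x, hx, rfl⟩ hxF
      refine Set.disjoint_left.1 hd hx ?_
      simp only [Finset.coe_image, Set.mem_image]
      exact ⟨h.symm x, hxF, by simp⟩)
    refine ⟨g⁻¹, fun x hx ↦ ?_⟩
    have h1 := hg (h.symm x) ⟨x, hx, rfl⟩
    rw [Homeomorph.apply_symm_apply] at h1
    rw [h1, proj_inv_proj]
    rfl

/-- The group of all homeomorphisms of the line that are piecewise-`SL₂(A)` with breakpoints in
`B`, for an `SL₂(A)`-invariant set `B ⊆ P¹(ℝ)`.  The group law is composition. -/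
def piecewiseGroup (A : Subring ℚ) (B : Set (OnePoint ℝ))
    (hB : ∀ g : SpecialLinearGroup (Fin 2) A, ∀ x ∈ B, proj ℝ g x ∈ B) : Subgroup (ℝ ≃ₜ ℝ) where
  carrier := {h | IsPiecewise A B h}
  mul_mem' := IsPiecewise.mul hB
  one_mem' := IsPiecewise.one A B
  inv_mem' := IsPiecewise.inv hB

/-- The fixed points in `P¹(ℝ)` of the hyperbolic elements (`trace² > 4`) of `SL₂(A)`. -/
def hyperbolicFixedPoints (A : Subring ℚ) : Set (OnePoint ℝ) :=
  {x | ∃ g : SpecialLinearGroup (Fin 2) A,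
    (4 : ℚ) < ((g 0 0 + g 1 1 : A) : ℚ) ^ 2 ∧ proj ℝ g x = x}

theorem hyperbolicFixedPoints_invariant (A : Subring ℚ) (g : SpecialLinearGroup (Fin 2) A) :
    ∀ x ∈ hyperbolicFixedPoints A, proj ℝ g x ∈ hyperbolicFixedPoints A := by
  rintro x ⟨k, hk, hx⟩
  refine ⟨g * k * g⁻¹, ?_, ?_⟩
  · have h1 : (g * k * g⁻¹) 0 0 + (g * k * g⁻¹) 1 1 = k 0 0 + k 1 1 := by
      have h3 := Matrix.trace_mul_comm (g * k : Matrix (Fin 2) (Fin 2) A)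
        (g⁻¹ : SpecialLinearGroup (Fin 2) A).1
      have h4 : (g⁻¹ : SpecialLinearGroup (Fin 2) A).1 * (g.1 * k.1) = k.1 := by
        change (g⁻¹ * (g * k)).1 = k.1
        rw [inv_mul_cancel_left]
      rw [h4, Matrix.trace_fin_two, Matrix.trace_fin_two] at h3
      exact h3
    rwa [h1]
  · rw [proj_mul, proj_inv_proj, proj_mul, hx]

/-- The group `H(A)`: piecewise-`SL₂(A)` homeomorphisms of the line whose breakpoints are fixed
points of hyperbolic elements of `SL₂(A)`. -/
def H (A : Subring ℚ) : Subgroup (ℝ ≃ₜ ℝ) :=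
  piecewiseGroup A (hyperbolicFixedPoints A) (hyperbolicFixedPoints_invariant A)

/-- The ring `ℤ[1/S]` of `S`-integers. -/
def ZInv (S : Set ℕ) : Subring ℚ := Subring.closure {x | ∃ q ∈ S, x = (q : ℚ)⁻¹}

/-- The group `Γ_S`: all piecewise-`SL₂(ℤ[1/S])` homeomorphisms of the line, without any condition
on the breakpoints. -/
def Gam (S : Set ℕ) : Subgroup (ℝ ≃ₜ ℝ) :=
  piecewiseGroup (ZInv S) Set.univ fun _ _ _ ↦ Set.mem_univ _

/-! ### The projective parts of a piecewise-projective homeomorphism -/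

/-- The homeomorphism of `P¹(ℝ)` extending `h`, which fixes `∞`. -/
abbrev extP1 (h : ℝ ≃ₜ ℝ) : OnePoint ℝ ≃ₜ OnePoint ℝ := h.onePointCongr

/-- `h` coincides with `g` on a neighbourhood of `x`. -/
def HasPart {A : Subring ℚ} (h : ℝ ≃ₜ ℝ) (x : OnePoint ℝ) (g : SpecialLinearGroup (Fin 2) A) :
    Prop :=
  ∀ᶠ y in 𝓝 x, extP1 h y = proj ℝ g y

open Classical in
/-- The projective part `h|_x` of `h` at `x`: a matrix `g ∈ SL₂(A)` (unique up to sign) coinciding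
with `h` near `x`.  It exists outside a finite set, on which the value `1` is chosen. -/
def part (A : Subring ℚ) (h : ℝ ≃ₜ ℝ) (x : OnePoint ℝ) : SpecialLinearGroup (Fin 2) A :=
  if H : ∃ g : SpecialLinearGroup (Fin 2) A, HasPart h x g then H.choose else 1

theorem hasPart_part {A : Subring ℚ} {h : ℝ ≃ₜ ℝ} {x : OnePoint ℝ}
    {g : SpecialLinearGroup (Fin 2) A} (hg : HasPart h x g) : HasPart h x (part A h x) := by
  have H : ∃ g : SpecialLinearGroup (Fin 2) A, HasPart h x g := ⟨g, hg⟩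
  rw [part, dif_pos H]
  exact H.choose_spec

theorem isOpen_hasPart {A : Subring ℚ} (h : ℝ ≃ₜ ℝ) (g : SpecialLinearGroup (Fin 2) A) :
    IsOpen {x | HasPart h x g} :=
  isOpen_setOfPred_eventually_nhds

theorem ext_mul (h k : ℝ ≃ₜ ℝ) (x : OnePoint ℝ) : extP1 (h * k) x = extP1 h (extP1 k x) := by
  induction x using OnePoint.rec <;> rfl

theorem ext_one (x : OnePoint ℝ) : extP1 1 x = x := by
  induction x using OnePoint.rec <;> rfl

theorem ext_symm (h : ℝ ≃ₜ ℝ) (x : OnePoint ℝ) : (extP1 h).symm x = extP1 h⁻¹ x := by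
  induction x using OnePoint.rec <;> rfl

theorem HasPart.mul {A : Subring ℚ} {h k : ℝ ≃ₜ ℝ} {x : OnePoint ℝ}
    {g g' : SpecialLinearGroup (Fin 2) A} (hg : HasPart h (extP1 k x) g) (hg' : HasPart k x g') :
    HasPart (h * k) x (g * g') := by
  have h1 := (extP1 k).continuous.continuousAt.eventually hg
  filter_upwards [h1, hg'] with y hy hy'
  rw [ext_mul, hy, hy', proj_mul]

theorem HasPart.one {A : Subring ℚ} (x : OnePoint ℝ) :
    HasPart 1 x (1 : SpecialLinearGroup (Fin 2) A) :=
  Eventually.of_forall fun y ↦ by rw [ext_one, proj_one]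

/-- Outside finitely many points, a piecewise-projective homeomorphism has a projective part. -/
theorem IsPiecewise.finite {A : Subring ℚ} {B : Set (OnePoint ℝ)} {h : ℝ ≃ₜ ℝ}
    (hh : IsPiecewise A B h) :
    {x | ¬ ∃ g : SpecialLinearGroup (Fin 2) A, HasPart h x g}.Finite := by
  obtain ⟨F, -, hF⟩ := hh
  refine ((F.finite_toSet.image ((↑) : ℝ → OnePoint ℝ)).insert OnePoint.infty).subset ?_
  intro x hx
  by_contra hxF
  apply hx
  induction x using OnePoint.rec with
  | infty => simp at hxF
  | coe x =>
    have hx' : x ∉ (F : Set ℝ) := fun h ↦ hxF (Or.inr ⟨x, h, rfl⟩)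
    obtain ⟨ε, hε, hb⟩ := Metric.isOpen_iff.1 F.finite_toSet.isClosed.isOpen_compl x hx'
    obtain ⟨g, hg⟩ := hF (Metric.ball x ε) (by
      rw [Real.ball_eq_Ioo]; exact Set.ordConnected_Ioo) (by
      rw [Metric.isOpen_ball.interior_eq]
      exact Set.disjoint_left.2 fun y hy hyF ↦ hb hy hyF)
    refine ⟨g, ?_⟩
    rw [HasPart, OnePoint.nhds_coe_eq, eventually_map]
    filter_upwards [Metric.ball_mem_nhds x hε] with y hy
    exact hg y hy

theorem ae_of_finite {s : Set (OnePoint ℝ)} (hs : s.Finite) : ∀ᵐ x ∂lebesgue, x ∉ s := by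
  rw [lebesgue, ae_map_iff OnePoint.continuous_coe.measurable.aemeasurable
    hs.measurableSet.compl]
  exact measure_mono_null (t := ((↑) : ℝ → OnePoint ℝ) ⁻¹' s) (fun x hx ↦ by simpa using hx)
    ((hs.preimage OnePoint.coe_injective.injOn).measure_zero _)

theorem proj_eq_self_of_eventually {A : Subring ℚ} (g : SpecialLinearGroup (Fin 2) A)
    {x : OnePoint ℝ} (hg : ∀ᶠ y in 𝓝 x, proj ℝ g y = y) {K : Type*} [Field K] [Algebra A K]
    (z : OnePoint K) : proj K g z = z := by
  classical
  obtain ⟨V, hV, hVo, hxV⟩ := eventually_nhds_iff.1 hg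
  have hUo : IsOpen (((↑) : ℝ → OnePoint ℝ) ⁻¹' V) := hVo.preimage OnePoint.continuous_coe
  obtain ⟨t, ht⟩ : (((↑) : ℝ → OnePoint ℝ) ⁻¹' V).Nonempty := by
    obtain ⟨t, ht⟩ := OnePoint.denseRange_coe.exists_mem_open hVo ⟨x, hxV⟩
    exact ⟨t, ht⟩
  have hinf : (((↑) : ℝ → OnePoint ℝ) ⁻¹' V).Infinite := infinite_of_mem_nhds t (hUo.mem_nhds ht)
  set φ : A →+* ℝ := algebraMap A ℝ
  have hφ : Function.Injective φ := FaithfulSMul.algebraMap_injective A ℝ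
  let P : Polynomial ℝ := Polynomial.C (φ (g 1 0)) * Polynomial.X ^ 2 +
    Polynomial.C (φ (g 1 1) - φ (g 0 0)) * Polynomial.X - Polynomial.C (φ (g 0 1))
  have hP : P = 0 := by
    refine Polynomial.eq_zero_of_infinite_isRoot P (hinf.mono fun y hy ↦ ?_)
    have h1 := hV y hy
    rw [proj_coe] at h1
    split_ifs at h1 with h2
    · exact absurd h1.symm (OnePoint.coe_ne_infty _)
    rw [OnePoint.coe_eq_coe, div_eq_iff h2] at h1
    simp only [P, Set.mem_ofPred_eq, Polynomial.IsRoot.def, Polynomial.eval_sub,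
      Polynomial.eval_add, Polynomial.eval_mul, Polynomial.eval_C, Polynomial.eval_pow,
      Polynomial.eval_X]
    linear_combination -h1
  have hc : g 1 0 = 0 := by
    have := congrArg (Polynomial.coeff · 2) hP
    exact hφ (by simpa [P, Polynomial.coeff_X, Polynomial.coeff_C] using this)
  have hda : g 1 1 = g 0 0 := by
    have := congrArg (Polynomial.coeff · 1) hP
    refine hφ (sub_eq_zero.1 ?_)
    simpa [P, Polynomial.coeff_X, Polynomial.coeff_C] using this
  have hb : g 0 1 = 0 := by
    have := congrArg (Polynomial.coeff · 0) hP
    exact hφ (by simpa [P, Polynomial.coeff_X, Polynomial.coeff_C] using this)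
  have hdet := g.det_coe
  rw [det_fin_two] at hdet
  have hdet' : g 0 0 * g 0 0 = 1 := by
    have : g 0 0 * g 1 1 - g 0 1 * g 1 0 = 1 := hdet
    rw [hc, hda] at this
    simpa using this
  have ha : algebraMap A K (g 0 0) ≠ 0 := by
    intro h0
    have := congrArg (algebraMap A K) hdet'
    simp [h0] at this
  induction z using OnePoint.rec with
  | infty =>
    rw [proj, OnePoint.smul_infty_eq_self_iff]
    change algebraMap A K (g 1 0) = 0
    rw [hc, map_zero]
  | coe z =>
    rw [proj_coe, hc, hb, hda, if_neg (by simpa using ha)]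
    congr 1
    field_simp
    simp [mul_div_cancel_left₀ _ ha]

/-- Two projective parts of `h` at a point induce the same map on every projective line. -/
theorem HasPart.unique {A : Subring ℚ} {h : ℝ ≃ₜ ℝ} {x : OnePoint ℝ}
    {g g' : SpecialLinearGroup (Fin 2) A} (hg : HasPart h x g) (hg' : HasPart h x g')
    {K : Type*} [Field K] [Algebra A K] : proj K g = proj K g' := by
  funext z
  have h1 : ∀ᶠ y in 𝓝 x, proj ℝ (g'⁻¹ * g) y = y := by
    filter_upwards [hg, hg'] with y hy hy'
    rw [proj_mul, ← hy, hy', proj_inv_proj]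
  have h2 := proj_eq_self_of_eventually _ h1 z
  rw [proj_mul] at h2
  rw [← proj_proj_inv g' (proj K g z), h2]

instance (A : Subring ℚ) : Countable (SpecialLinearGroup (Fin 2) A) :=
  inferInstanceAs (Countable {M : Fin 2 → Fin 2 → A // Matrix.det (n := Fin 2) M = 1})

theorem ext_preserves_null {A : Subring ℚ} {B : Set (OnePoint ℝ)} {h : ℝ ≃ₜ ℝ}
    (hh : IsPiecewise A B h) {P : OnePoint ℝ → Prop} (hP : ∀ᵐ x ∂lebesgue, P x) :
    ∀ᵐ x ∂lebesgue, P (extP1 h⁻¹ x) := by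
  classical
  have hcoe : Measurable ((↑) : ℝ → OnePoint ℝ) := OnePoint.continuous_coe.measurable
  have hemb : MeasurableEmbedding ((↑) : ℝ → OnePoint ℝ) :=
    OnePoint.isOpenEmbedding_coe.measurableEmbedding
  rw [lebesgue, hemb.ae_map_iff] at hP ⊢
  have hkey : ∀ g : SpecialLinearGroup (Fin 2) A,
      volume (h '' ({x : ℝ | ¬ P x} ∩ {x : ℝ | HasPart h x g})) = 0 := by
    intro g
    refine addHaar_image_eq_zero_of_differentiableOn_of_addHaar_eq_zero volume (f := h) ?_
      (measure_mono_null Set.inter_subset_left hP)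
    rintro x ⟨-, hx⟩
    refine DifferentiableAt.differentiableWithinAt ?_
    have hx' : ∀ᶠ y : ℝ in 𝓝 x, ((h y : ℝ) : OnePoint ℝ) = proj ℝ g y := by
      have := hx
      rw [Set.mem_ofPred_eq, HasPart, OnePoint.nhds_coe_eq, eventually_map] at this
      exact this
    have hy : ∀ᶠ y : ℝ in 𝓝 x, h y =
        (algebraMap A ℝ (g 0 0) * y + algebraMap A ℝ (g 0 1)) /
          (algebraMap A ℝ (g 1 0) * y + algebraMap A ℝ (g 1 1)) := by
      filter_upwards [hx'] with y hy
      rw [proj_coe] at hy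
      split_ifs at hy with h2
      · exact absurd hy (OnePoint.coe_ne_infty _)
      · exact OnePoint.coe_injective hy
    have hx0 : algebraMap A ℝ (g 1 0) * x + algebraMap A ℝ (g 1 1) ≠ 0 := by
      intro h0
      have := hx'.self_of_nhds
      rw [proj_coe, if_pos h0] at this
      exact OnePoint.coe_ne_infty _ this
    refine DifferentiableAt.congr_of_eventuallyEq ?_ hy
    exact DifferentiableAt.fun_div (by fun_prop) (by fun_prop) hx0
  have hfin : volume (h '' (((↑) : ℝ → OnePoint ℝ) ⁻¹'
      {x | ¬ ∃ g : SpecialLinearGroup (Fin 2) A, HasPart h x g})) = 0 :=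
    ((hh.finite.preimage OnePoint.coe_injective.injOn).image h).measure_zero _
  refine measure_mono_null ?_ (measure_union_null (measure_iUnion_null hkey) hfin)
  intro x hx
  have hx1 : ¬ P ((h.symm x : ℝ) : OnePoint ℝ) := hx
  by_cases hg : ∃ g : SpecialLinearGroup (Fin 2) A, HasPart h (h.symm x : ℝ) g
  · obtain ⟨g, hg⟩ := hg
    exact Or.inl (Set.mem_iUnion.2 ⟨g, h.symm x, ⟨hx1, hg⟩, by simp⟩)
  · exact Or.inr ⟨h.symm x, hg, by simp⟩

/-! ### The convex compact space of measurable maps `P¹(ℝ) → Prob(P¹(ℚ_p))` -/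

section K

variable (p : ℕ) [Fact p.Prime]

/-- `Prob(P¹(ℚ_p))`: Borel probability measures with the weak-* topology.  Mathlib's σ-algebra on
it is generated by the evaluations on Borel sets; as `P¹(ℚ_p)` is compact and metrisable, it is the
Borel σ-algebra of the weak-* topology. -/
abbrev Prob : Type := ProbabilityMeasure (OnePoint ℚ_[p])

/-- Measurable maps `P¹(ℝ) → Prob(P¹(ℚ_p))`. -/
abbrev MeasMap : Type := {f : OnePoint ℝ → Prob p // Measurable f}

/-- Equality outside a null-set. -/
instance aeSetoid : Setoid (MeasMap p) where
  r f f' := f.1 =ᵐ[lebesgue] f'.1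
  iseqv := ⟨fun _ ↦ EventuallyEq.rfl, fun h ↦ h.symm, fun h h' ↦ h.trans h'⟩

/-- The space `K` of measurable maps `P¹(ℝ) → Prob(P¹(ℚ_p))`, where two maps are identified when
they agree outside a null-set. -/
def K : Type := Quotient (aeSetoid p)

/-- The pairing `⟨f, φ⟩ = ∫ ⟨f(x), φ(x)⟩ dx` of `f ∈ K` with `φ ∈ L¹(P¹(ℝ), C(P¹(ℚ_p)))`, as a map
from `K` to the functions on that `L¹`-space; it realises `K` in the dual of the `L¹`-space. -/
def K.pairing : K p → (Lp C(OnePoint ℚ_[p], ℝ) 1 lebesgue → ℝ) :=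
  Quotient.lift
    (fun f φ ↦ ∫ x, (∫ y, φ x y ∂((f.1 x : Measure (OnePoint ℚ_[p])))) ∂lebesgue) (by
      intro f f' h
      funext φ
      refine integral_congr_ae ?_
      filter_upwards [h] with x hx
      rw [hx])

/-- The weak-* topology on `K`, viewed in the dual of `L¹(P¹(ℝ), C(P¹(ℚ_p)))`. -/
instance : TopologicalSpace (K p) := TopologicalSpace.induced (K.pairing p) inferInstance

variable {p} {A : Subring ℚ}

/-- The action of `SL₂(A)` on `Prob(P¹(ℚ_p))` by push-forward. -/
def push (g : SpecialLinearGroup (Fin 2) A) (μ : Prob p) : Prob p :=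
  μ.map (f := proj ℚ_[p] g) (measurable_proj g).aemeasurable

theorem push_congr {g g' : SpecialLinearGroup (Fin 2) A}
    (h : proj ℚ_[p] g = proj ℚ_[p] g') (μ : Prob p) : push g μ = push g' μ := by
  apply Subtype.ext
  change Measure.map _ _ = Measure.map _ _
  rw [h]

theorem push_mul (g g' : SpecialLinearGroup (Fin 2) A) (μ : Prob p) :
    push (g * g') μ = push g (push g' μ) := by
  apply Subtype.ext
  change Measure.map _ _ = Measure.map _ (Measure.map _ _)
  rw [Measure.map_map (measurable_proj g) (measurable_proj g')]
  congr 1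
  funext x
  exact proj_mul g g' x

theorem push_one (μ : Prob p) : push (1 : SpecialLinearGroup (Fin 2) A) μ = μ := by
  apply Subtype.ext
  change Measure.map _ _ = _
  have : proj ℚ_[p] (1 : SpecialLinearGroup (Fin 2) A) = id := funext proj_one
  rw [this, Measure.map_id]
  rfl

theorem measurable_push (g : SpecialLinearGroup (Fin 2) A) :
    Measurable (push g : Prob p → Prob p) :=
  Measurable.subtype_mk ((Measure.measurable_map _ (measurable_proj g)).comp measurable_subtype_coe)

/-- The formula `(h.f)(x) = h|_{h⁻¹x} (f (h⁻¹ x))`. -/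
def actFun (A : Subring ℚ) (h : ℝ ≃ₜ ℝ) (f : OnePoint ℝ → Prob p) (x : OnePoint ℝ) : Prob p :=
  push (part A h ((extP1 h).symm x)) (f ((extP1 h).symm x))

theorem push_part {h : ℝ ≃ₜ ℝ} {x : OnePoint ℝ} {g : SpecialLinearGroup (Fin 2) A}
    (hg : HasPart h x g) (μ : Prob p) : push (part A h x) μ = push g μ :=
  push_congr ((hasPart_part hg).unique hg) μ

theorem measurable_push_part {B : Set (OnePoint ℝ)} {h : ℝ ≃ₜ ℝ} (hh : IsPiecewise A B h)
    {f : OnePoint ℝ → Prob p} (hf : Measurable f) :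
    Measurable fun x ↦ push (part A h x) (f x) := by
  intro s hs
  have hN := hh.finite
  set N : Set (OnePoint ℝ) := {x | ¬ ∃ g : SpecialLinearGroup (Fin 2) A, HasPart h x g} with hNdef
  set F : OnePoint ℝ → Prob p := fun x ↦ push (part A h x) (f x) with hF
  have h1 : ∀ g : SpecialLinearGroup (Fin 2) A,
      MeasurableSet ({x | HasPart h x g} ∩ (fun x ↦ push g (f x)) ⁻¹' s) := fun g ↦
    (isOpen_hasPart h g).measurableSet.inter (((measurable_push g).comp hf) hs)
  have h2 : MeasurableSet (N ∩ F ⁻¹' s) := (hN.subset Set.inter_subset_left).measurableSet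
  have h3 : F ⁻¹' s = (⋃ g : SpecialLinearGroup (Fin 2) A,
      {x | HasPart h x g} ∩ (fun x ↦ push g (f x)) ⁻¹' s) ∪ (N ∩ F ⁻¹' s) := by
    ext x
    rw [Set.mem_union, Set.mem_iUnion, Set.mem_inter_iff, Set.mem_preimage]
    constructor
    · intro hxs
      by_cases hx : ∃ g : SpecialLinearGroup (Fin 2) A, HasPart h x g
      · obtain ⟨g, hg⟩ := hx
        exact Or.inl ⟨part A h x, hasPart_part hg, hxs⟩
      · exact Or.inr ⟨hx, hxs⟩
    · rintro (⟨g, hg, hxs⟩ | hxs)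
      · rw [hF]
        beta_reduce
        rw [push_part hg]
        exact hxs
      · exact hxs.2
  rw [h3]
  exact (MeasurableSet.iUnion h1).union h2

theorem measurable_actFun {B : Set (OnePoint ℝ)} {h : ℝ ≃ₜ ℝ} (hh : IsPiecewise A B h)
    {f : OnePoint ℝ → Prob p} (hf : Measurable f) : Measurable (actFun A h f) :=
  (measurable_push_part hh hf).comp (extP1 h).symm.continuous.measurable

theorem actFun_congr {B : Set (OnePoint ℝ)} {h : ℝ ≃ₜ ℝ} (hh : IsPiecewise A B h)
    {f f' : OnePoint ℝ → Prob p} (hf : f =ᵐ[lebesgue] f') :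
    actFun A h f =ᵐ[lebesgue] actFun A h f' := by
  filter_upwards [ext_preserves_null hh hf] with x hx
  rw [actFun, actFun, ext_symm, hx]

theorem actFun_one (f : OnePoint ℝ → Prob p) : actFun A 1 f = f := by
  funext x
  have h1 : HasPart 1 x (1 : SpecialLinearGroup (Fin 2) A) := HasPart.one x
  rw [actFun, ext_symm, inv_one, ext_one, push_part h1]
  exact push_one _

theorem actFun_mul {B : Set (OnePoint ℝ)} {h k : ℝ ≃ₜ ℝ} (hh : IsPiecewise A B h)
    (hk : IsPiecewise A B k) (f : OnePoint ℝ → Prob p) :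
    actFun A (h * k) f =ᵐ[lebesgue] actFun A h (actFun A k f) := by
  have h1 := ext_preserves_null hh (ae_of_finite hh.finite)
  have h2 := ext_preserves_null hh (ext_preserves_null hk (ae_of_finite hk.finite))
  filter_upwards [h1, h2] with x hx1 hx2
  simp only [not_not] at hx1 hx2
  obtain ⟨g, hg⟩ := hx1
  obtain ⟨g', hg'⟩ := hx2
  have h5 : extP1 (h * k)⁻¹ x = extP1 k⁻¹ (extP1 h⁻¹ x) := by rw [mul_inv_rev, ext_mul]
  simp only [actFun, ext_symm, h5]
  have h3 : extP1 k (extP1 k⁻¹ (extP1 h⁻¹ x)) = extP1 h⁻¹ x := by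
    rw [← ext_mul, mul_inv_cancel, ext_one]
  have h4 : HasPart (h * k) (extP1 k⁻¹ (extP1 h⁻¹ x))
      (part A h (extP1 h⁻¹ x) * part A k (extP1 k⁻¹ (extP1 h⁻¹ x))) :=
    HasPart.mul (by rw [h3]; exact hasPart_part hg) (hasPart_part hg')
  rw [← push_mul]
  exact push_part h4 _

/-- The action of a group of piecewise-`SL₂(A)` homeomorphisms on `K`, given by
`(h.f)(x) = h|_{h⁻¹x} (f (h⁻¹ x))`. -/
instance {B : Set (OnePoint ℝ)}
    {hB : ∀ g : SpecialLinearGroup (Fin 2) A, ∀ x ∈ B, proj ℝ g x ∈ B} :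
    MulAction (piecewiseGroup A B hB) (K p) where
  smul h := Quotient.map (fun f ↦ ⟨actFun A h.1 f.1, measurable_actFun h.2 f.2⟩)
    fun _ _ hf ↦ actFun_congr h.2 hf
  one_smul := by
    rintro ⟨f⟩
    exact Quotient.sound (.of_eq (actFun_one f.1))
  mul_smul := by
    rintro h k ⟨f⟩
    exact Quotient.sound (actFun_mul h.2 k.2 f.1)

instance (S : Set ℕ) : MulAction (Gam S) (K p) :=
  inferInstanceAs (MulAction (piecewiseGroup (ZInv S) Set.univ _) (K p))

end K

/-! ### Amenability -/

/-- `K` is a convex compact `G`-space, realised by `ι` as a compact convex subset of the topological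
vector space `E`, on which `G` acts by affine homeomorphisms. -/
structure IsConvexCompactSpace (G : Type*) {K E : Type*} [Group G] [TopologicalSpace K]
    [MulAction G K] [AddCommGroup E] [Module ℝ E] [TopologicalSpace E] (ι : K → E) : Prop where
  isEmbedding : IsEmbedding ι
  isCompact_range : IsCompact (Set.range ι)
  convex_range : Convex ℝ (Set.range ι)
  continuous_smul : ∀ g : G, Continuous fun x : K ↦ g • x
  smul_affine : ∀ (g : G) (x y z : K) (a b : ℝ), 0 ≤ a → 0 ≤ b → a + b = 1 →
    ι z = a • ι x + b • ι y → ι (g • z) = a • ι (g • x) + b • ι (g • y)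

/-- A group is amenable if every non-empty convex compact `G`-space, realised in some locally convex
Hausdorff topological vector space, has a fixed point. -/
def IsAmenable.{u} (G : Type u) [Group G] : Prop :=
  ∀ (E K : Type u) [AddCommGroup E] [Module ℝ E] [TopologicalSpace E] [IsTopologicalAddGroup E]
    [ContinuousSMul ℝ E] [LocallyConvexSpace ℝ E] [T2Space E]
    [TopologicalSpace K] [MulAction G K] (ι : K → E),
    Nonempty K → IsConvexCompactSpace G ι → ∃ x : K, ∀ g : G, g • x = x

end PiecewiseProjective

end

/-!
The reasons behind the four assertions are as follows.

*Breakpoints.* At a breakpoint `b`, the two projective parts of `h` differ by an element of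
`SL₂(A)` fixing `b`. Having a real fixed point, such an element is hyperbolic, or central (and `b`
is no breakpoint), or parabolic. In the parabolic case `b` is rational, and every rational point is
fixed by a hyperbolic element: `diag(p, p⁻¹)` fixes `∞`, and `SL₂(ℤ)` is transitive on the rational
points (`IsPiecewise.of_univ`).

*Compactness.* `K` is identified with the set of functionals on `L¹(P¹(ℝ), C(P¹(ℚ_p)))` that are
linear, of norm at most `1`, positive, and given by the integral on functions constant in the second
variable (`IsState`, `range_pairing`). This set is visibly convex, and closed in a product of
compact intervals. That every such functional is a field of measures follows from the
Riesz–Markov–Kakutani theorem on the compact space `P¹(ℝ) × P¹(ℚ_p)` and a disintegration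
(`IsState.exists_pair_eq`). The action is by affine homeomorphisms because it is dual to an operator
on `L¹` (`exists_pair_actFun_eq`).

*Absence of fixed points.* The translation by `p⁻ⁿ` belongs to `Γ_S`. For large `n` it is small on
`ℝ` but pushes any given ball of `ℚ_p` into the sphere of radius `pⁿ`. These spheres are disjoint,
so a field of probability measures invariant under all these translations gives mass zero to balls,
and is the constant field `δ_∞` (`ae_range_coe_eq_zero`). But `Γ_S` has an element that coincides on
an interval with `x ↦ (2x+1)/(x+1)`, and this transformation does not fix `∞` (`not_exists_fixed`).

*Non-amenability* is then witnessed by `K` itself.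
-/

noncomputable section

namespace PiecewiseProjective

/-! ### Topology of the projective line -/

/-- A countable basis consists of the countable basis of `X` together with the complements of the
sets of a compact exhaustion. -/
instance secondCountableTopology_onePoint {X : Type*} [TopologicalSpace X] [T2Space X]
    [WeaklyLocallyCompactSpace X] [SecondCountableTopology X] :
    SecondCountableTopology (OnePoint X) := by
  let E := CompactExhaustion.choice X
  refine TopologicalSpace.IsTopologicalBasis.secondCountableTopology
    (b := ((fun U ↦ ((↑) : X → OnePoint X) '' U) '' TopologicalSpace.countableBasis X) ∪
      Set.range fun n ↦ (((↑) : X → OnePoint X) '' E n)ᶜ) ?_ ?_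
  · refine TopologicalSpace.isTopologicalBasis_of_isOpen_of_nhds ?_ ?_
    · rintro _ (⟨U, hU, rfl⟩ | ⟨n, rfl⟩)
      · exact OnePoint.isOpen_image_coe.2 (TopologicalSpace.isOpen_of_mem_countableBasis hU)
      · exact OnePoint.isOpen_compl_image_coe.2 ⟨(E.isCompact n).isClosed, E.isCompact n⟩
    · intro a u ha hu
      induction a using OnePoint.rec with
      | infty =>
        obtain ⟨n, hn⟩ := E.exists_superset_of_isCompact
          ((OnePoint.isOpen_iff_of_mem ha).1 hu).2
        refine ⟨_, Or.inr ⟨n, rfl⟩, by simp, ?_⟩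
        intro z hz
        induction z using OnePoint.rec with
        | infty => exact ha
        | coe z =>
          by_contra h
          exact hz ⟨z, hn h, rfl⟩
      | coe x =>
        obtain ⟨U, hU, hxU, hUu⟩ :=
          (TopologicalSpace.isBasis_countableBasis X).exists_subset_of_mem_open
            (show x ∈ ((↑) : X → OnePoint X) ⁻¹' u from ha) (hu.preimage OnePoint.continuous_coe)
        exact ⟨_, Or.inl ⟨U, hU, rfl⟩, ⟨x, hxU, rfl⟩, Set.image_subset_iff.2 hUu⟩
  · exact ((TopologicalSpace.countable_countableBasis X).image _).union (Set.countable_range _)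

open Classical in
theorem proj_infty {K A : Type*} [CommRing A] [Field K] [Algebra A K]
    (g : SpecialLinearGroup (Fin 2) A) :
    proj K g OnePoint.infty = if algebraMap A K (g 1 0) = 0 then OnePoint.infty
      else ((algebraMap A K (g 0 0) / algebraMap A K (g 1 0) : K) : OnePoint K) := by
  rw [proj, OnePoint.smul_infty_eq_ite]
  rfl

/-- The map `z ↦ -1/z` on the projective line. -/
def negInv (K : Type*) [Field K] (z : OnePoint K) : OnePoint K :=
  proj K (ModularGroup.S : SpecialLinearGroup (Fin 2) ℤ) z

section
variable {K : Type*} [NormedField K]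

theorem negInv_coe (z : K) [Decidable (z = 0)] :
    negInv K z = if z = 0 then OnePoint.infty else ((-z⁻¹ : K) : OnePoint K) := by
  rw [negInv, proj_coe]
  simp [ModularGroup.S, neg_div]

theorem negInv_infty : negInv K OnePoint.infty = ((0 : K) : OnePoint K) := by
  rw [negInv, proj_infty]
  simp [ModularGroup.S]

theorem continuous_negInv [ProperSpace K] : Continuous (negInv K) := by
  classical
  rw [continuous_iff_continuousAt]
  intro z
  induction z using OnePoint.rec with
  | infty =>
    rw [OnePoint.continuousAt_infty', negInv_infty, Filter.coclosedCompact_eq_cocompact,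
      ← Metric.cobounded_eq_cocompact]
    have h : Tendsto (fun z : K ↦ ((-z⁻¹ : K) : OnePoint K)) (Bornology.cobounded K)
        (𝓝 ((0 : K) : OnePoint K)) := by
      have := (tendsto_inv₀_cobounded (α := K)).neg
      rw [neg_zero] at this
      exact (OnePoint.continuous_coe.tendsto _).comp this
    refine h.congr' ?_
    filter_upwards [Bornology.isBounded_singleton (x := (0 : K))] with z hz
    rw [Function.comp_apply, negInv_coe, if_neg (by simpa using hz)]
  | coe z =>
    rw [OnePoint.continuousAt_coe]
    by_cases hz : z = 0
    · subst hz
      rw [continuousAt_iff_punctured_nhds]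
      have h0 : (negInv K ∘ ((↑) : K → OnePoint K)) 0 = OnePoint.infty := by
        rw [Function.comp_apply, negInv_coe, if_pos rfl]
      rw [h0]
      have h : Tendsto (fun z : K ↦ ((-z⁻¹ : K) : OnePoint K)) (𝓝[≠] 0)
          (𝓝 (OnePoint.infty : OnePoint K)) := by
        refine OnePoint.tendsto_coe_infty.comp ?_
        rw [Filter.coclosedCompact_eq_cocompact, ← Metric.cobounded_eq_cocompact]
        exact tendsto_neg_cobounded.comp tendsto_inv₀_nhdsNE_zero
      refine h.congr' ?_
      filter_upwards [self_mem_nhdsWithin] with z hz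
      rw [Function.comp_apply, negInv_coe, if_neg (by simpa using hz)]
    · have hev : (negInv K ∘ ((↑) : K → OnePoint K)) =ᶠ[𝓝 z] fun y ↦ ((-y⁻¹ : K) : OnePoint K) := by
        filter_upwards [isOpen_ne.mem_nhds hz] with y hy
        rw [Function.comp_apply, negInv_coe, if_neg hy]
      refine ContinuousAt.congr ?_ hev.symm
      exact OnePoint.continuous_coe.continuousAt.comp (continuousAt_inv₀ hz).neg

/-- The affine map `z ↦ a z + b` as a homeomorphism of the projective line fixing `∞`. -/
def affineP1 (a b : K) (ha : a ≠ 0) : OnePoint K ≃ₜ OnePoint K :=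
  ((Homeomorph.mulLeft₀ a ha).trans (Homeomorph.addRight b)).onePointCongr

theorem affineP1_coe (a b : K) (ha : a ≠ 0) (z : K) :
    affineP1 a b ha z = ((a * z + b : K) : OnePoint K) := rfl

theorem affineP1_infty (a b : K) (ha : a ≠ 0) :
    affineP1 a b ha OnePoint.infty = OnePoint.infty := rfl

theorem bruhat_identity {F : Type*} [Field F] {a b c d z : F} (hc : c ≠ 0) (h : c * z + d ≠ 0)
    (hdet : a * d - b * c = 1) :
    (a * z + b) / (c * z + d) = 1 * -(c * (c * z + d))⁻¹ + a / c := by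
  obtain ⟨w, hw⟩ : ∃ w, w = c * z + d := ⟨_, rfl⟩
  rw [← hw] at h ⊢
  field_simp
  rw [hw]
  linear_combination -hdet

/-- By the Bruhat decomposition, a projective transformation is affine or the composition of two
affine maps with `z ↦ -1/z` in between. -/
theorem continuous_proj [ProperSpace K] {A : Type*} [CommRing A] [Algebra A K]
    (g : SpecialLinearGroup (Fin 2) A) : Continuous (proj K g) := by
  classical
  obtain ⟨a, ha⟩ : ∃ a, a = algebraMap A K (g 0 0) := ⟨_, rfl⟩
  obtain ⟨b, hb⟩ : ∃ b, b = algebraMap A K (g 0 1) := ⟨_, rfl⟩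
  obtain ⟨c, hc⟩ : ∃ c, c = algebraMap A K (g 1 0) := ⟨_, rfl⟩
  obtain ⟨d, hd⟩ : ∃ d, d = algebraMap A K (g 1 1) := ⟨_, rfl⟩
  have hdet : a * d - b * c = 1 := by
    have := g.det_coe
    rw [det_fin_two] at this
    simpa [ha, hb, hc, hd] using congrArg (algebraMap A K) this
  have hinf : proj K g OnePoint.infty =
      if c = 0 then OnePoint.infty else ((a / c : K) : OnePoint K) := by
    rw [proj_infty, ha, hc]
  by_cases h : c = 0
  · have had : a * d = 1 := by simpa [h] using hdet
    have hd0 : d ≠ 0 := right_ne_zero_of_mul_eq_one had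
    have ha0 : a ≠ 0 := left_ne_zero_of_mul_eq_one had
    suffices proj K g = affineP1 (a / d) (b / d) (div_ne_zero ha0 hd0) by
      rw [this]; exact Homeomorph.continuous _
    funext z
    induction z using OnePoint.rec with
    | infty => rw [hinf, if_pos h, affineP1_infty]
    | coe z =>
      rw [proj_coe, ← ha, ← hb, ← hc, ← hd, affineP1_coe, h, if_neg (by simpa using hd0)]
      rw [zero_mul, zero_add, add_div, mul_div_right_comm]
  · suffices proj K g = affineP1 1 (a / c) one_ne_zero ∘ negInv K ∘
        affineP1 (c ^ 2) (c * d) (pow_ne_zero 2 h) by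
      rw [this]
      exact (Homeomorph.continuous _).comp (continuous_negInv.comp (Homeomorph.continuous _))
    funext z
    induction z using OnePoint.rec with
    | infty =>
      rw [hinf, if_neg h, Function.comp_apply, Function.comp_apply, affineP1_infty, negInv_infty,
        affineP1_coe]
      simp
    | coe z =>
      have hfac : c ^ 2 * z + c * d = c * (c * z + d) := by ring
      rw [proj_coe, ← ha, ← hb, ← hc, ← hd, Function.comp_apply, Function.comp_apply, affineP1_coe,
        negInv_coe, hfac]
      by_cases h0 : c * z + d = 0
      · rw [if_pos h0, if_pos (by rw [h0, mul_zero]), affineP1_infty]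
      · rw [if_neg h0, if_neg (mul_ne_zero h h0), affineP1_coe]
        rw [bruhat_identity h h0 hdet]
end

/-! ### Measurable fields of probability measures as functionals on `L¹(Y, C(X))` -/

section State

variable {X Y : Type*} [TopologicalSpace X] [CompactSpace X] [MeasurableSpace Y] {lam : Measure Y}

/-- The functionals on `L¹(Y, C(X))` which are linear, of norm at most `1`, positive, and restrict
to the integral on `L¹(Y) = L¹(Y, ℝ 1)`.  They turn out to be the measurable fields of probability
measures. -/
structure IsState (Λ : Lp C(X, ℝ) 1 lam → ℝ) : Prop where
  map_add : ∀ φ ψ, Λ (φ + ψ) = Λ φ + Λ ψ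
  map_smul : ∀ (a : ℝ) φ, Λ (a • φ) = a * Λ φ
  abs_le : ∀ φ, |Λ φ| ≤ ‖φ‖
  nonneg : ∀ φ : Lp C(X, ℝ) 1 lam, (∀ᵐ x ∂lam, ∀ y, 0 ≤ φ x y) → 0 ≤ Λ φ
  map_const : ∀ (φ : Lp C(X, ℝ) 1 lam) (u : Y → ℝ), Integrable u lam →
    (∀ᵐ x ∂lam, ∀ y, φ x y = u x) → Λ φ = ∫ x, u x ∂lam

namespace IsState

variable {Λ : Lp C(X, ℝ) 1 lam → ℝ}

theorem map_sub (h : IsState Λ) (φ ψ : Lp C(X, ℝ) 1 lam) : Λ (φ - ψ) = Λ φ - Λ ψ := by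
  have := h.map_add φ ((-1 : ℝ) • ψ)
  rw [h.map_smul] at this
  rw [show φ - ψ = φ + (-1 : ℝ) • ψ by rw [neg_one_smul, sub_eq_add_neg], this]
  ring

theorem continuous (h : IsState Λ) : Continuous Λ := by
  refine (LipschitzWith.of_dist_le_mul (K := 1) fun φ ψ ↦ ?_).continuous
  rw [Real.dist_eq, ← h.map_sub, NNReal.coe_one, one_mul, dist_eq_norm]
  exact h.abs_le _

end IsState

theorem isClosed_setOf_isState : IsClosed {Λ : Lp C(X, ℝ) 1 lam → ℝ | IsState Λ} := by
  have h : {Λ : Lp C(X, ℝ) 1 lam → ℝ | IsState Λ} =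
      {Λ | ∀ φ ψ, Λ (φ + ψ) = Λ φ + Λ ψ} ∩ {Λ | ∀ (a : ℝ) φ, Λ (a • φ) = a * Λ φ} ∩
      {Λ | ∀ φ, |Λ φ| ≤ ‖φ‖} ∩
      {Λ | ∀ φ : Lp C(X, ℝ) 1 lam, (∀ᵐ x ∂lam, ∀ y, 0 ≤ φ x y) → 0 ≤ Λ φ} ∩
      {Λ | ∀ (φ : Lp C(X, ℝ) 1 lam) (u : Y → ℝ), Integrable u lam →
        (∀ᵐ x ∂lam, ∀ y, φ x y = u x) → Λ φ = ∫ x, u x ∂lam} := by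
    ext Λ
    exact ⟨fun h ↦ ⟨⟨⟨⟨h.1, h.2⟩, h.3⟩, h.4⟩, h.5⟩,
      fun h ↦ ⟨h.1.1.1.1, h.1.1.1.2, h.1.1.2, h.1.2, h.2⟩⟩
  rw [h]
  simp only [Set.ofPred_forall]
  refine ((((?_ : IsClosed _).inter ?_).inter ?_).inter ?_).inter ?_
  · exact isClosed_iInter fun φ ↦ isClosed_iInter fun ψ ↦ isClosed_eq (by fun_prop) (by fun_prop)
  · exact isClosed_iInter fun φ ↦ isClosed_iInter fun ψ ↦ isClosed_eq (by fun_prop) (by fun_prop)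
  · exact isClosed_iInter fun φ ↦ isClosed_le (by fun_prop) (by fun_prop)
  · exact isClosed_iInter fun φ ↦ isClosed_iInter fun _ ↦ isClosed_le (by fun_prop) (by fun_prop)
  · exact isClosed_iInter fun φ ↦ isClosed_iInter fun _ ↦ isClosed_iInter fun _ ↦
      isClosed_iInter fun _ ↦ isClosed_eq (by fun_prop) (by fun_prop)

theorem isCompact_setOf_isState : IsCompact {Λ : Lp C(X, ℝ) 1 lam → ℝ | IsState Λ} :=
  (isCompact_univ_pi fun φ : Lp C(X, ℝ) 1 lam ↦
    isCompact_Icc (a := -‖φ‖) (b := ‖φ‖)).of_isClosed_subset isClosed_setOf_isState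
    fun _ h φ _ ↦ abs_le.1 (h.abs_le φ)

theorem convex_setOf_isState : Convex ℝ {Λ : Lp C(X, ℝ) 1 lam → ℝ | IsState Λ} := by
  intro Λ h Λ' h' a b ha hb hab
  refine ⟨fun φ ψ ↦ ?_, fun t φ ↦ ?_, fun φ ↦ ?_, fun φ hφ ↦ ?_, fun φ u hu hφ ↦ ?_⟩ <;>
    simp only [Pi.add_apply, Pi.smul_apply, smul_eq_mul]
  · rw [h.map_add, h'.map_add]; ring
  · rw [h.map_smul, h'.map_smul]; ring
  · have h1 := _root_.abs_le.1 (h.abs_le φ)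
    have h2 := _root_.abs_le.1 (h'.abs_le φ)
    have hb' : b = 1 - a := by linarith
    rw [_root_.abs_le, hb']
    have hb'' : 0 ≤ 1 - a := by linarith
    constructor <;> nlinarith [mul_le_mul_of_nonneg_left h1.1 ha, mul_le_mul_of_nonneg_left h1.2 ha,
      mul_le_mul_of_nonneg_left h2.1 hb'', mul_le_mul_of_nonneg_left h2.2 hb'']
  · exact add_nonneg (mul_nonneg ha (h.nonneg φ hφ)) (mul_nonneg hb (h'.nonneg φ hφ))
  · rw [h.map_const φ u hu hφ, h'.map_const φ u hu hφ, ← add_mul, hab, one_mul]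

theorem abs_integral_continuousMap_le [MeasurableSpace X] (c : C(X, ℝ)) (μ : Measure X)
    [IsProbabilityMeasure μ] : |∫ y, c y ∂μ| ≤ ‖c‖ := by
  simpa using norm_integral_le_of_norm_le_const (μ := μ) (f := c)
    (Eventually.of_forall c.norm_coe_le_norm)

end State

section Pairing

variable {X Y : Type*} [TopologicalSpace X] [CompactSpace X] [MeasurableSpace X] [BorelSpace X]
  [MeasurableSpace Y] {lam : Measure Y}

theorem integrable_continuousMap [T2Space X] [SecondCountableTopology X] (c : C(X, ℝ))
    (μ : Measure X) [IsFiniteMeasure μ] : Integrable c μ :=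
  c.continuous.integrable_of_hasCompactSupport (HasCompactSupport.of_compactSpace _)

variable [T2Space X] [SecondCountableTopology X]

/-- A measurable family of probability measures, as a Markov kernel. -/
def toKernel {f : Y → ProbabilityMeasure X} (hf : Measurable f) : ProbabilityTheory.Kernel Y X :=
  ⟨fun x ↦ f x, measurable_subtype_coe.comp hf⟩

instance {f : Y → ProbabilityMeasure X} (hf : Measurable f) :
    ProbabilityTheory.IsMarkovKernel (toKernel hf) :=
  ⟨fun x ↦ inferInstanceAs (IsProbabilityMeasure (f x : Measure X))⟩

theorem aestronglyMeasurable_integral_fiber {f : Y → ProbabilityMeasure X} (hf : Measurable f)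
    {φ : Y → C(X, ℝ)} (hφ : AEStronglyMeasurable φ lam) :
    AEStronglyMeasurable (fun x ↦ ∫ y, φ x y ∂(f x : Measure X)) lam := by
  obtain ⟨ψ, hψ, h⟩ := hφ
  refine ⟨fun x ↦ ∫ y, ψ x y ∂(f x : Measure X), ?_, ?_⟩
  · have h1 : StronglyMeasurable fun z : Y × X ↦ ψ z.1 z.2 :=
      (continuous_eval (F := C(X, ℝ))).comp_stronglyMeasurable
        ((hψ.comp_measurable measurable_fst).prodMk measurable_snd.stronglyMeasurable)
    exact h1.integral_kernel_prod_right' (κ := toKernel hf)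
  · filter_upwards [h] with x hx
    rw [hx]

theorem integrable_integral_fiber {f : Y → ProbabilityMeasure X} (hf : Measurable f)
    {φ : Y → C(X, ℝ)} (hφ : Integrable φ lam) :
    Integrable (fun x ↦ ∫ y, φ x y ∂(f x : Measure X)) lam :=
  hφ.norm.mono' (aestronglyMeasurable_integral_fiber hf hφ.1)
    (Eventually.of_forall fun _ ↦ abs_integral_continuousMap_le _ _)

/-- The pairing `⟨f, φ⟩ = ∫ ⟨f(x), φ(x)⟩ dx` of a measurable field of probability measures with an
`L¹`-function with values in `C(X)`. -/
def pair (f : Y → ProbabilityMeasure X) (φ : Lp C(X, ℝ) 1 lam) : ℝ :=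
  ∫ x, (∫ y, φ x y ∂(f x : Measure X)) ∂lam

theorem isState_pair {f : Y → ProbabilityMeasure X} (hf : Measurable f) :
    IsState (pair f : Lp C(X, ℝ) 1 lam → ℝ) where
  map_add φ ψ := by
    rw [pair, pair, pair, ← integral_add
      (integrable_integral_fiber hf (L1.integrable_coeFn φ))
      (integrable_integral_fiber hf (L1.integrable_coeFn ψ))]
    refine integral_congr_ae ?_
    filter_upwards [Lp.coeFn_add φ ψ] with x hx
    simp_rw [hx, Pi.add_apply, ContinuousMap.add_apply]
    exact integral_add (integrable_continuousMap _ _) (integrable_continuousMap _ _)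
  map_smul a φ := by
    rw [pair, pair, ← integral_const_mul]
    refine integral_congr_ae ?_
    filter_upwards [Lp.coeFn_smul a φ] with x hx
    simp_rw [hx, Pi.smul_apply, ContinuousMap.smul_apply, smul_eq_mul]
    exact integral_const_mul _ _
  abs_le φ := by
    rw [L1.norm_eq_integral_norm]
    refine norm_integral_le_of_norm_le (G := ℝ) (L1.integrable_coeFn φ).norm
      (Eventually.of_forall fun x ↦ ?_)
    exact abs_integral_continuousMap_le (φ x) _
  nonneg φ hφ := by
    refine integral_nonneg_of_ae ?_
    filter_upwards [hφ] with x hx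
    exact integral_nonneg hx
  map_const φ u hu hφ := by
    refine integral_congr_ae ?_
    filter_upwards [hφ] with x hx
    simp [hx]

/-- Two measurable fields of probability measures with the same pairings agree almost everywhere:
`C(X)` is separable, and a probability measure on `X` is determined by its integrals of continuous
functions. -/
theorem ae_eq_of_pair_eq [SigmaFinite lam] {f f' : Y → ProbabilityMeasure X} (hf : Measurable f)
    (hf' : Measurable f') (h : (pair f : Lp C(X, ℝ) 1 lam → ℝ) = pair f') : f =ᵐ[lam] f' := by
  have hm : ∀ {f : Y → ProbabilityMeasure X}, Measurable f → ∀ (c : C(X, ℝ)) {s : Set Y},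
      MeasurableSet s → lam s < ⊤ → IntegrableOn (fun x ↦ ∫ y, c y ∂(f x : Measure X)) s lam := by
    intro f hf c s hs hs'
    have : IsFiniteMeasure (lam.restrict s) := ⟨by simpa using hs'⟩
    exact integrable_integral_fiber hf (integrable_const c)
  have hc : ∀ c : C(X, ℝ), ∀ᵐ x ∂lam,
      ∫ y, c y ∂(f x : Measure X) = ∫ y, c y ∂(f' x : Measure X) := by
    intro c
    refine ae_eq_of_forall_setIntegral_eq_of_sigmaFinite (fun s hs hs' ↦ hm hf c hs hs')
      (fun s hs hs' ↦ hm hf' c hs hs') fun s hs hs' ↦ ?_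
    have key : ∀ f : Y → ProbabilityMeasure X, pair f (indicatorConstLp 1 hs hs'.ne c) =
        ∫ x in s, ∫ y, c y ∂(f x : Measure X) ∂lam := by
      intro f
      rw [pair, ← integral_indicator hs]
      refine integral_congr_ae ?_
      filter_upwards [indicatorConstLp_coeFn (p := 1) (hs := hs) (hμs := hs'.ne) (c := c)] with x hx
      rw [hx]
      by_cases hxs : x ∈ s <;> simp [hxs]
    rw [← key, ← key, h]
  have hall := ae_all_iff.2 fun n ↦ hc (TopologicalSpace.denseSeq C(X, ℝ) n)
  filter_upwards [hall] with x hx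
  have hcont : ∀ μ : ProbabilityMeasure X,
      Continuous fun c : C(X, ℝ) ↦ ∫ y, c y ∂(μ : Measure X) := by
    intro μ
    refine (LipschitzWith.of_dist_le_mul (K := 1) fun c c' ↦ ?_).continuous
    rw [Real.dist_eq, ← integral_sub (integrable_continuousMap _ _) (integrable_continuousMap _ _),
      NNReal.coe_one, one_mul, dist_eq_norm]
    exact abs_integral_continuousMap_le (c - c') _
  have heq := (TopologicalSpace.denseRange_denseSeq C(X, ℝ)).equalizer (hcont (f x))
    (hcont (f' x)) (funext hx)
  let _ := TopologicalSpace.metrizableSpaceMetric X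
  have h1 : (f x : Measure X) = f' x :=
    ext_of_forall_integral_eq_of_IsFiniteMeasure fun c ↦ congrFun heq c.toContinuousMap
  exact Subtype.ext h1

end Pairing

section Representation

variable {X Y : Type*} [TopologicalSpace X] [CompactSpace X] [T2Space X]
  [SecondCountableTopology X] [MeasurableSpace X] [BorelSpace X] [Nonempty X]
  [TopologicalSpace Y] [CompactSpace Y] [T2Space Y] [SecondCountableTopology Y]
  [MeasurableSpace Y] [BorelSpace Y] {lam : Measure Y}

open scoped CompactlySupported in
/-- The positive functional `F ↦ Λ (x ↦ F(x, ·))` on `C(Y × X)` attached to a state `Λ`. -/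
def stateFunctional [IsFiniteMeasure lam] {Λ : Lp C(X, ℝ) 1 lam → ℝ} (h : IsState Λ) :
    C_c(Y × X, ℝ) →ₚ[ℝ] ℝ :=
  PositiveLinearMap.mk₀
    { toFun := fun F ↦ Λ (ContinuousMap.toLp 1 lam ℝ F.toContinuousMap.curry)
      map_add' := fun F G ↦ by
        rw [← h.map_add, ← _root_.map_add]; rfl
      map_smul' := fun a F ↦ by
        rw [RingHom.id_apply, smul_eq_mul, ← h.map_smul, ← _root_.map_smul]; rfl }
    fun F hF ↦ h.nonneg _ (by
      filter_upwards [ContinuousMap.coeFn_toLp (p := 1) (𝕜 := ℝ) lam F.toContinuousMap.curry]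
        with x hx y
      rw [hx]
      exact hF (x, y))

/-- The measure on `Y × X` representing a state is disintegrated over its first marginal. -/
theorem IsState.exists_pair_eq_of_isFiniteMeasure [IsFiniteMeasure lam]
    {Λ : Lp C(X, ℝ) 1 lam → ℝ} (h : IsState Λ) :
    ∃ f : Y → ProbabilityMeasure X, Measurable f ∧ Λ = pair f := by
  let _ := TopologicalSpace.metrizableSpaceMetric X
  let _ := TopologicalSpace.metrizableSpaceMetric Y
  set ρ : Measure (Y × X) := RealRMK.rieszMeasure (stateFunctional h) with hρ
  have hint : ∀ F : C(Y × X, ℝ), ∫ z, F z ∂ρ = Λ (ContinuousMap.toLp 1 lam ℝ F.curry) := fun F ↦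
    RealRMK.integral_rieszMeasure (stateFunctional h)
      ⟨F, HasCompactSupport.of_compactSpace _⟩
  have : IsFiniteMeasure ρ := inferInstance
  -- The normalisation on functions of the first variable determines the first marginal.
  have hfst : ρ.fst = lam := by
    refine ext_of_forall_integral_eq_of_IsFiniteMeasure fun u ↦ ?_
    rw [Measure.fst, integral_map measurable_fst.aemeasurable
      u.continuous.aestronglyMeasurable]
    refine (hint ⟨fun z ↦ u z.1, by fun_prop⟩).trans ?_
    refine h.map_const _ u (u.integrable _) ?_
    filter_upwards [ContinuousMap.coeFn_toLp (p := 1) (𝕜 := ℝ) lam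
      (ContinuousMap.curry (⟨fun z ↦ u z.1, by fun_prop⟩ : C(Y × X, ℝ)))] with x hx y
    rw [hx]
    rfl
  refine ⟨fun x ↦ ⟨ρ.condKernel x, inferInstance⟩,
    Measurable.subtype_mk ρ.condKernel.measurable, ?_⟩
  set f : Y → ProbabilityMeasure X := fun x ↦ ⟨ρ.condKernel x, inferInstance⟩ with hf
  have hfm : Measurable f := Measurable.subtype_mk ρ.condKernel.measurable
  -- Both functionals are continuous, so they need only be compared on `C(Y, C(X))`.
  refine (ContinuousMap.toLp_denseRange C(X, ℝ) lam ℝ ENNReal.one_ne_top).equalizer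
    h.continuous (isState_pair hfm).continuous ?_
  funext F
  have h1 := hint F.uncurry
  rw [← ρ.disintegrate ρ.condKernel, Measure.integral_compProd
    (integrable_continuousMap F.uncurry _), hfst] at h1
  rw [Function.comp_apply, Function.comp_apply]
  have h2 : F.uncurry.curry = F := by ext; rfl
  rw [h2] at h1
  rw [← h1, pair]
  refine integral_congr_ae ?_
  filter_upwards [ContinuousMap.coeFn_toLp (p := 1) (𝕜 := ℝ) lam F] with x hx
  rw [hx]
  rfl

/-- Every state is the pairing with a measurable field of probability measures: after replacing
the measure by an equivalent finite one, the Riesz representation theorem on `Y × X` applies. -/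
theorem IsState.exists_pair_eq [SigmaFinite lam] {Λ : Lp C(X, ℝ) 1 lam → ℝ} (h : IsState Λ) :
    ∃ f : Y → ProbabilityMeasure X, Measurable f ∧ Λ = pair f := by
  obtain ⟨w, hw0, hwm, hw⟩ := exists_pos_lintegral_lt_of_sigmaFinite lam one_ne_zero
  set ν : Measure Y := lam.withDensity fun x ↦ w x with hν
  have : IsFiniteMeasure ν := isFiniteMeasure_withDensity hw.ne_top
  have hae : ∀ {P : Y → Prop}, (∀ᵐ x ∂ν, P x) → ∀ᵐ x ∂lam, P x := by
    intro P hP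
    filter_upwards [(ae_withDensity_iff hwm.coe_nnreal_ennreal).1 hP] with x hx
    exact hx (by simpa using (hw0 x).ne')
  let T : Lp C(X, ℝ) 1 ν →ₗᵢ[ℝ] Lp C(X, ℝ) 1 lam := withDensitySMulLI lam hwm
  have hT : ∀ ψ : Lp C(X, ℝ) 1 ν, ∀ᵐ x ∂lam, T ψ x = w x • ψ x := fun ψ ↦
    (memL1_smul_of_L1_withDensity hwm ψ).coeFn_toLp
  have hΛT : IsState (lam := ν) fun ψ : Lp C(X, ℝ) 1 ν ↦ Λ (T ψ) := by
    refine ⟨fun φ ψ ↦ ?_, fun a φ ↦ ?_, fun φ ↦ ?_, fun φ hφ ↦ ?_, fun φ u hu hφ ↦ ?_⟩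
    · rw [_root_.map_add, h.map_add]
    · rw [_root_.map_smul, h.map_smul]
    · rw [← T.norm_map φ]
      exact h.abs_le _
    · refine h.nonneg _ ?_
      filter_upwards [hT φ, hae hφ] with x hx hx' y
      rw [hx]
      exact mul_nonneg (w x).2 (hx' y)
    · rw [integral_withDensity_eq_integral_smul hwm]
      refine h.map_const _ _ ((integrable_withDensity_iff_integrable_smul hwm).1 hu) ?_
      filter_upwards [hT φ, hae hφ] with x hx hx' y
      rw [hx, ← hx' y]
      rfl
  obtain ⟨f, hf, hΛf⟩ := hΛT.exists_pair_eq_of_isFiniteMeasure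
  refine ⟨f, hf, funext fun φ ↦ ?_⟩
  -- As `w` is positive, the isometry `T : ψ ↦ w • ψ` is onto, with inverse `φ ↦ w⁻¹ • φ`.
  have hmem : Integrable (fun x ↦ (w x)⁻¹ • φ x) ν := by
    rw [hν, integrable_withDensity_iff_integrable_smul hwm]
    refine (L1.integrable_coeFn φ).congr (Eventually.of_forall fun x ↦ ?_)
    beta_reduce
    rw [smul_smul, mul_inv_cancel₀ (hw0 x).ne', one_smul]
  set ψ : Lp C(X, ℝ) 1 ν := hmem.toL1 _ with hψ
  have hψφ : T ψ = φ := by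
    refine Lp.ext ?_
    filter_upwards [hT ψ, hae hmem.coeFn_toL1] with x hx hx'
    rw [hx, hx', smul_smul, mul_inv_cancel₀ (hw0 x).ne', one_smul]
  rw [← hψφ]
  refine (congrFun hΛf ψ).trans ?_
  rw [pair, pair, integral_withDensity_eq_integral_smul hwm]
  refine integral_congr_ae ?_
  filter_upwards [hT ψ] with x hx
  rw [hx]
  exact (integral_const_mul ((w x : ℝ)) _).symm

end Representation

/-! ### The convex compact space `K` and the action on it -/

theorem sigmaFinite_map_of_measurableEmbedding {α β : Type*} [MeasurableSpace α]
    [MeasurableSpace β] {e : α → β} (he : MeasurableEmbedding e) (μ : Measure α) [SigmaFinite μ] :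
    SigmaFinite (μ.map e) :=
  ⟨⟨{ set := fun n ↦ e '' spanningSets μ n ∪ (Set.range e)ᶜ
      set_mem := fun _ ↦ trivial
      finite := fun n ↦ by
        rw [he.map_apply, Set.preimage_union, Set.preimage_image_eq _ he.injective,
          Set.preimage_compl, Set.preimage_range, Set.compl_univ, Set.union_empty]
        exact measure_spanningSets_lt_top μ n
      spanning := by
        rw [← Set.iUnion_union, ← Set.image_iUnion, iUnion_spanningSets, Set.image_univ,
          Set.union_compl_self] }⟩⟩

instance : SigmaFinite lebesgue :=
  sigmaFinite_map_of_measurableEmbedding OnePoint.isOpenEmbedding_coe.measurableEmbedding volume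

section

variable {p : ℕ} [Fact p.Prime] {A : Subring ℚ}

theorem pairing_mk (f : MeasMap p) : K.pairing p (Quotient.mk _ f) = pair f.1 := rfl

theorem range_pairing : Set.range (K.pairing p) = {Λ | IsState Λ} := by
  ext Λ
  constructor
  · rintro ⟨⟨f⟩, rfl⟩
    exact isState_pair f.2
  · intro h
    obtain ⟨f, hf, hΛ⟩ := h.exists_pair_eq
    exact ⟨Quotient.mk _ ⟨f, hf⟩, hΛ.symm⟩

theorem injective_pairing : Function.Injective (K.pairing p) := by
  rintro ⟨f⟩ ⟨f'⟩ h
  exact Quotient.sound (ae_eq_of_pair_eq f.2 f'.2 h)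

theorem isEmbedding_pairing : IsEmbedding (K.pairing p) :=
  ⟨⟨rfl⟩, injective_pairing⟩

/-- Pull-back of continuous functions on `P¹(ℚ_p)` by a projective transformation. -/
def pullback (p : ℕ) [Fact p.Prime] (g : SpecialLinearGroup (Fin 2) A)
    (c : C(OnePoint ℚ_[p], ℝ)) : C(OnePoint ℚ_[p], ℝ) :=
  c.comp ⟨proj ℚ_[p] g, continuous_proj g⟩

theorem norm_pullback_le (g : SpecialLinearGroup (Fin 2) A) (c : C(OnePoint ℚ_[p], ℝ)) :
    ‖pullback p g c‖ ≤ ‖c‖ :=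
  (ContinuousMap.norm_le _ (norm_nonneg _)).2 fun _ ↦ c.norm_coe_le_norm _

theorem integral_push (g : SpecialLinearGroup (Fin 2) A) (μ : Prob p)
    (c : C(OnePoint ℚ_[p], ℝ)) :
    ∫ y, c y ∂(push g μ : Measure (OnePoint ℚ_[p])) = ∫ y, pullback p g c y ∂(μ : Measure _) :=
  integral_map (measurable_proj g).aemeasurable c.continuous.aestronglyMeasurable

/-- Measurability holds because `x ↦ part A h (h⁻¹ x)` takes, up to sign, a single value on each of
countably many open sets whose union is conull. -/
theorem integrable_pullback_part {B : Set (OnePoint ℝ)} {h : ℝ ≃ₜ ℝ} (hh : IsPiecewise A B h)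
    {φ : OnePoint ℝ → C(OnePoint ℚ_[p], ℝ)} (hφ : Integrable φ lebesgue) :
    Integrable (fun x ↦ pullback p (part A h (extP1 h⁻¹ x)) (φ x)) lebesgue := by
  refine hφ.norm.mono' ?_ (Eventually.of_forall fun x ↦ norm_pullback_le _ _)
  have hm : ∀ g : SpecialLinearGroup (Fin 2) A,
      MeasurableSet {x | HasPart h (extP1 h⁻¹ x) g} := fun g ↦
    ((isOpen_hasPart h g).preimage (extP1 h⁻¹).continuous).measurableSet
  have hall : ∀ᵐ x ∂lebesgue, x ∈ ⋃ g : SpecialLinearGroup (Fin 2) A,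
      {x | HasPart h (extP1 h⁻¹ x) g} := by
    filter_upwards [ext_preserves_null hh (ae_of_finite hh.finite)] with x hx
    simpa using hx
  rw [← Measure.restrict_eq_self_of_ae_mem hall, aestronglyMeasurable_iUnion_iff]
  intro g
  refine AEStronglyMeasurable.congr (f := fun x ↦ pullback p g (φ x)) ?_ ?_
  · exact ((ContinuousMap.continuous_precomp _).comp_aestronglyMeasurable hφ.1).restrict
  · filter_upwards [ae_restrict_mem (hm g)] with x hx
    refine ContinuousMap.ext fun y ↦ ?_
    exact congrArg (φ x) (congrFun (hx.unique (hasPart_part hx) (K := ℚ_[p])) y)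

/-- The action is dual to an operator on `L¹(P¹(ℝ), C(P¹(ℚ_p)))`: a change of variables by `h`
moves the action from the field of measures to the test function, up to a Radon–Nikodym
derivative. -/
theorem exists_pair_actFun_eq {B : Set (OnePoint ℝ)} {h : ℝ ≃ₜ ℝ} (hh : IsPiecewise A B h)
    (φ : Lp C(OnePoint ℚ_[p], ℝ) 1 lebesgue) :
    ∃ φ' : Lp C(OnePoint ℚ_[p], ℝ) 1 lebesgue, ∀ f : OnePoint ℝ → Prob p,
      pair (actFun A h f) φ = pair f φ' := by
  let e : OnePoint ℝ ≃ᵐ OnePoint ℝ := (extP1 h).symm.toMeasurableEquiv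
  have he : ∀ x, e x = extP1 h⁻¹ x := fun x ↦ ext_symm h x
  have hhe : ∀ x, extP1 h (e x) = x := fun x ↦ (extP1 h).apply_symm_apply x
  set μ : Measure (OnePoint ℝ) := lebesgue.map e with hμ
  have : SigmaFinite μ := sigmaFinite_map_of_measurableEmbedding e.measurableEmbedding lebesgue
  have hac : μ ≪ lebesgue := by
    refine Measure.AbsolutelyContinuous.mk fun s hs h0 ↦ ?_
    rw [hμ, e.map_apply]
    have h1 : ∀ᵐ x ∂lebesgue, x ∉ s := measure_eq_zero_iff_ae_notMem.1 h0
    exact measure_eq_zero_iff_ae_notMem.2 (ext_preserves_null hh h1)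
  set ψ : OnePoint ℝ → C(OnePoint ℚ_[p], ℝ) :=
    fun x ↦ pullback p (part A h x) (φ (extP1 h x)) with hψ
  have hψi : Integrable ψ μ := by
    rw [hμ, integrable_map_equiv]
    refine (integrable_pullback_part hh (L1.integrable_coeFn φ)).congr
      (Eventually.of_forall fun x ↦ ?_)
    simp only [Function.comp_apply, hψ, hhe]
    rw [he]
  have hψi' := (integrable_rnDeriv_smul_iff hac).2 hψi
  refine ⟨hψi'.toL1 _, fun f ↦ ?_⟩
  have h1 : pair (actFun A h f) φ = ∫ x, ∫ y, ψ x y ∂(f x : Measure _) ∂μ := by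
    rw [hμ, integral_map_equiv, pair]
    congr 1
    funext x
    rw [actFun, integral_push, hψ]
    beta_reduce
    rw [hhe]
    rfl
  rw [h1, ← integral_rnDeriv_smul hac, pair]
  refine integral_congr_ae ?_
  filter_upwards [hψi'.coeFn_toL1] with x hx
  rw [hx]
  exact (integral_const_mul _ _).symm

theorem isConvexCompactSpace_pairing (S : Set ℕ) :
    IsConvexCompactSpace (Gam S) (K.pairing p) where
  isEmbedding := isEmbedding_pairing
  isCompact_range := by
    rw [range_pairing]
    exact isCompact_setOf_isState
  convex_range := by
    rw [range_pairing]
    exact convex_setOf_isState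
  continuous_smul h := by
    rw [isEmbedding_pairing.continuous_iff, continuous_pi_iff]
    intro φ
    obtain ⟨φ', hφ'⟩ := exists_pair_actFun_eq (p := p) h.2 φ
    have : (fun f : K p ↦ K.pairing p (h • f) φ) = fun f ↦ K.pairing p f φ' := by
      funext f
      obtain ⟨f⟩ := f
      exact hφ' f.1
    exact (this ▸ (continuous_apply φ').comp isEmbedding_pairing.continuous :
      Continuous fun f : K p ↦ K.pairing p (h • f) φ)
  smul_affine h := by
    rintro ⟨f₁⟩ ⟨f₂⟩ ⟨f⟩ a b - - - hf
    funext φ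
    obtain ⟨φ', hφ'⟩ := exists_pair_actFun_eq (p := p) h.2 φ
    have h1 : pair f.1 φ' = a * pair f₁.1 φ' + b * pair f₂.1 φ' := congrFun hf φ'
    rw [← hφ', ← hφ', ← hφ'] at h1
    exact h1

end

/-! ### Translations: a fixed field of measures is concentrated at `∞` -/

theorem ae_lebesgue_iff {P : OnePoint ℝ → Prop} :
    (∀ᵐ x ∂lebesgue, P x) ↔ ∀ᵐ x : ℝ, P x :=
  OnePoint.isOpenEmbedding_coe.measurableEmbedding.ae_map_iff

/-- The matrix of the translation `x ↦ x + b`. -/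
def transMat {A : Subring ℚ} (b : A) : SpecialLinearGroup (Fin 2) A :=
  ⟨!![1, b; 0, 1], by simp [det_fin_two]⟩

theorem proj_transMat_coe {A : Subring ℚ} {K : Type*} [Field K] [Algebra A K] (b : A) (x : K) :
    proj K (transMat b) x = ((x + algebraMap A K b : K) : OnePoint K) := by
  rw [proj_coe]
  simp [transMat]

theorem proj_transMat_infty {A : Subring ℚ} {K : Type*} [Field K] [Algebra A K] (b : A) :
    proj K (transMat b) (OnePoint.infty : OnePoint K) = OnePoint.infty := by
  rw [proj_infty]
  simp [transMat]

theorem addRight_mem_Gam {S : Set ℕ} (b : ZInv S) :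
    Homeomorph.addRight (algebraMap (ZInv S) ℝ b) ∈ Gam S :=
  ⟨∅, by simp, fun I _ _ ↦ ⟨transMat b, fun x _ ↦ (proj_transMat_coe b x).symm⟩⟩

theorem hasPart_addRight {A : Subring ℚ} (b : A) (x : OnePoint ℝ) :
    HasPart (Homeomorph.addRight (algebraMap A ℝ b)) x (transMat b) := by
  refine Eventually.of_forall fun y ↦ ?_
  induction y using OnePoint.rec with
  | infty => exact (proj_transMat_infty b).symm
  | coe y => exact (proj_transMat_coe b y).symm

/-- The point of `K` given by a measurable field of probability measures. -/
def K.mk {p : ℕ} [Fact p.Prime] (f : MeasMap p) : K p := Quotient.mk _ f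

theorem ae_eq_actFun_of_smul_eq {S : Set ℕ} {p : ℕ} [Fact p.Prime] {f : MeasMap p}
    (hf : ∀ h : Gam S, h • K.mk f = K.mk f) {h : ℝ ≃ₜ ℝ}
    (hh : h ∈ Gam S) : actFun (ZInv S) h f.1 =ᵐ[lebesgue] f.1 :=
  Quotient.exact (hf ⟨h, hh⟩)

/-- A finite measure cannot charge infinitely many disjoint sets by a fixed amount; here the sets
move with the translations `t n`. -/
theorem setLIntegral_eq_zero_of_translates {X : Type*} [MeasurableSpace X] {μ : ℝ → Measure X}
    [∀ x, IsProbabilityMeasure (μ x)] (hμ : Measurable μ) {U : Set X} {W : ℕ → Set X}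
    (hW : ∀ n, MeasurableSet (W n)) (hWd : Pairwise (Function.onFun Disjoint W)) {t : ℕ → ℝ}
    (ht0 : ∀ n, 0 ≤ t n) (ht1 : ∀ n, t n ≤ 1)
    (h : ∀ n, ∀ᵐ x : ℝ, μ x U ≤ μ (x - t n) (W n)) (a b : ℝ) :
    ∫⁻ x in Set.Icc a b, μ x U = 0 := by
  by_contra h0
  have hmeas : ∀ n, Measurable fun x ↦ μ x (W n) := fun n ↦
    (Measure.measurable_coe (hW n)).comp hμ
  have hle : ∀ n, ∫⁻ x in Set.Icc a b, μ x U ≤ ∫⁻ x in Set.Icc (a - 1) b, μ x (W n) := by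
    intro n
    calc ∫⁻ x in Set.Icc a b, μ x U
        ≤ ∫⁻ x in Set.Icc a b, (Set.Icc (a - 1) b).indicator (fun z ↦ μ z (W n)) (x - t n) := by
          refine lintegral_mono_ae ?_
          filter_upwards [ae_restrict_of_ae (h n), ae_restrict_mem measurableSet_Icc] with x hx hxI
          rw [Set.indicator_of_mem]
          · exact hx
          · exact ⟨by linarith [hxI.1, ht1 n], by linarith [hxI.2, ht0 n]⟩
      _ ≤ ∫⁻ x, (Set.Icc (a - 1) b).indicator (fun z ↦ μ z (W n)) (x - t n) :=
          setLIntegral_le_lintegral _ _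
      _ = ∫⁻ x, (Set.Icc (a - 1) b).indicator (fun z ↦ μ z (W n)) x :=
          lintegral_sub_right_eq_self _ _
      _ = ∫⁻ x in Set.Icc (a - 1) b, μ x (W n) := lintegral_indicator measurableSet_Icc _
  have htop : ∑' _ : ℕ, ∫⁻ x in Set.Icc a b, μ x U = ⊤ := ENNReal.tsum_const_eq_top_of_ne_zero h0
  have hlt : ∑' n, ∫⁻ x in Set.Icc (a - 1) b, μ x (W n) < ⊤ := by
    rw [← lintegral_tsum fun n ↦ (hmeas n).aemeasurable]
    calc ∫⁻ x in Set.Icc (a - 1) b, ∑' n, μ x (W n)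
        ≤ ∫⁻ x in Set.Icc (a - 1) b, 1 := by
          refine lintegral_mono fun x ↦ ?_
          rw [← measure_iUnion hWd hW]
          exact prob_le_one
      _ < ⊤ := by simp
  exact absurd (htop ▸ ENNReal.tsum_le_tsum hle) (not_le.2 hlt)

theorem inv_pow_mem_ZInv {S : Set ℕ} {p : ℕ} (hp : p ∈ S) (n : ℕ) :
    ((p : ℚ)⁻¹) ^ n ∈ ZInv S :=
  pow_mem (show (p : ℚ)⁻¹ ∈ ZInv S from Subring.subset_closure ⟨p, hp, rfl⟩) n

/-- Translation by `p⁻ⁿ` is small in `ℝ` but moves every ball of `ℚ_p` to a far away sphere, so a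
field of measures invariant under these translations is concentrated at `∞`. -/
theorem ae_range_coe_eq_zero {S : Set ℕ} {p : ℕ} [hpp : Fact p.Prime] (hp : p ∈ S) {f : MeasMap p}
    (hf : ∀ h : Gam S, h • K.mk f = K.mk f) :
    ∀ᵐ x ∂lebesgue,
      (f.1 x : Measure (OnePoint ℚ_[p])) (Set.range ((↑) : ℚ_[p] → OnePoint ℚ_[p])) = 0 := by
  have hp1 : (1 : ℝ) < p := by exact_mod_cast hpp.out.one_lt
  have hp0 : (0 : ℝ) < p := by linarith
  let b : ℕ → ZInv S := fun n ↦ ⟨((p : ℚ)⁻¹) ^ n, inv_pow_mem_ZInv hp n⟩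
  have hbR : ∀ n, algebraMap (ZInv S) ℝ (b n) = ((p : ℝ)⁻¹) ^ n := fun n ↦ by
    change (((b n : ℚ)) : ℝ) = _
    simp [b]
  have hbQ : ∀ n, ‖algebraMap (ZInv S) ℚ_[p] (b n)‖ = (p : ℝ) ^ n := fun n ↦ by
    change ‖(((b n : ℚ)) : ℚ_[p])‖ = _
    simp [b]
  have hball : ∀ m : ℕ, ∀ᵐ x : ℝ, (f.1 x : Measure (OnePoint ℚ_[p]))
      (((↑) : ℚ_[p] → OnePoint ℚ_[p]) '' Metric.closedBall 0 m) = 0 := by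
    intro m
    -- From `n = N` on, the translation by `p⁻ⁿ` moves the ball into the sphere of radius `pⁿ`.
    obtain ⟨N, hN⟩ := pow_unbounded_of_one_lt (m : ℝ) hp1
    have hUm : MeasurableSet (((↑) : ℚ_[p] → OnePoint ℚ_[p]) '' Metric.closedBall 0 m) :=
      ((isCompact_closedBall _ _).image OnePoint.continuous_coe).isClosed.measurableSet
    have hzero : ∀ k : ℕ, ∫⁻ x in Set.Icc (-k : ℝ) k, (f.1 x : Measure (OnePoint ℚ_[p]))
        (((↑) : ℚ_[p] → OnePoint ℚ_[p]) '' Metric.closedBall 0 m) = 0 := by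
      intro k
      refine setLIntegral_eq_zero_of_translates
        (μ := fun x : ℝ ↦ (f.1 x : Measure (OnePoint ℚ_[p])))
        (W := fun n ↦ ((↑) : ℚ_[p] → OnePoint ℚ_[p]) '' Metric.sphere 0 ((p : ℝ) ^ (n + N)))
        (t := fun n ↦ ((p : ℝ)⁻¹) ^ (n + N))
        (measurable_subtype_coe.comp (f.2.comp OnePoint.continuous_coe.measurable))
        (fun n ↦ ((isCompact_sphere _ _).image
          OnePoint.continuous_coe).isClosed.measurableSet) ?_
        (fun n ↦ by positivity) (fun n ↦ pow_le_one₀ (by positivity) (inv_le_one_of_one_le₀ hp1.le))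
        ?_ _ _
      · intro n n' hn
        refine (Set.disjoint_image_iff OnePoint.coe_injective).2
          (Set.disjoint_left.2 fun y hy hy' ↦ hn ?_)
        rw [mem_sphere_zero_iff_norm] at hy hy'
        have := pow_right_injective₀ hp0 hp1.ne' (hy.symm.trans hy')
        simpa using this
      · intro n
        have h1 := ae_lebesgue_iff.1 (ae_eq_actFun_of_smul_eq hf (addRight_mem_Gam (b (n + N))))
        filter_upwards [h1] with x hx
        have hsymm : (extP1 (Homeomorph.addRight (algebraMap (ZInv S) ℝ (b (n + N))))).symm
            (x : OnePoint ℝ) = ((x - ((p : ℝ)⁻¹) ^ (n + N) : ℝ) : OnePoint ℝ) := by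
          rw [← hbR]; rfl
        rw [actFun, hsymm, push_part (hasPart_addRight _ _)] at hx
        rw [← hx]
        refine (Measure.map_apply (measurable_proj _) hUm).le.trans (measure_mono ?_)
        intro y hy
        induction y using OnePoint.rec with
        | infty =>
          rw [Set.mem_preimage, proj_transMat_infty] at hy
          simp at hy
        | coe y =>
          rw [Set.mem_preimage, proj_transMat_coe, OnePoint.coe_injective.mem_set_image,
            mem_closedBall_zero_iff] at hy
          refine ⟨y, ?_, rfl⟩
          rw [mem_sphere_zero_iff_norm, ← hbQ]
          set β := algebraMap (ZInv S) ℚ_[p] (b (n + N))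
          have hβ : (m : ℝ) < ‖β‖ := by
            rw [hbQ]
            exact hN.trans_le (pow_le_pow_right₀ hp1.le (Nat.le_add_left _ _))
          have h2 : ‖(y + β) + -β‖ = max ‖y + β‖ ‖-β‖ :=
            Padic.add_eq_max_of_ne (by rw [norm_neg]; exact (hy.trans_lt hβ).ne)
          rw [add_neg_cancel_right, norm_neg, max_eq_right (hy.trans hβ.le)] at h2
          exact h2
    have hmeas : Measurable fun x : ℝ ↦ (f.1 x : Measure (OnePoint ℚ_[p]))
        (((↑) : ℚ_[p] → OnePoint ℚ_[p]) '' Metric.closedBall 0 m) :=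
      (Measure.measurable_coe hUm).comp
        (measurable_subtype_coe.comp (f.2.comp OnePoint.continuous_coe.measurable))
    have h2 : ∀ k : ℕ, ∀ᵐ x : ℝ, x ∈ Set.Icc (-k : ℝ) k → (f.1 x : Measure (OnePoint ℚ_[p]))
        (((↑) : ℚ_[p] → OnePoint ℚ_[p]) '' Metric.closedBall 0 m) = 0 := fun k ↦
      (ae_restrict_iff' measurableSet_Icc).1 ((lintegral_eq_zero_iff hmeas).1 (hzero k))
    filter_upwards [ae_all_iff.2 h2] with x hx
    obtain ⟨k, hk⟩ := exists_nat_ge |x|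
    exact hx k (abs_le.1 hk)
  rw [ae_lebesgue_iff]
  filter_upwards [ae_all_iff.2 hball] with x hx
  rw [← Set.image_univ, ← Metric.iUnion_closedBall_nat (0 : ℚ_[p]), Set.image_iUnion]
  exact measure_iUnion_null hx

/-! ### A compactly supported element which is hyperbolic on an interval -/

/-- An order-connected set of reals with `b` outside its interior lies on one side of `b`. -/
theorem subset_Iic_or_subset_Ici {I : Set ℝ} (hI : I.OrdConnected) {b : ℝ} (hb : b ∉ interior I) :
    I ⊆ Set.Iic b ∨ I ⊆ Set.Ici b := by
  by_contra! h
  obtain ⟨⟨x, hx, hxb⟩, y, hy, hyb⟩ := Set.not_subset.1 h.1, Set.not_subset.1 h.2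
  rw [Set.mem_Iic, not_le] at hxb
  rw [Set.mem_Ici, not_le] at hyb
  exact hb (mem_interior.2 ⟨Set.Ioo y x, fun z hz ↦ hI.out hy hx (Set.Ioo_subset_Icc_self hz),
    isOpen_Ioo, hyb, hxb⟩)

/-- The function which is `u` on `[a, b]` and the identity elsewhere. -/
def glueFun (a b : ℝ) (u : ℝ → ℝ) (x : ℝ) : ℝ :=
  if x ∈ Set.Icc a b then u x else x

theorem continuous_glueFun {a b : ℝ} (hab : a ≤ b) {u : ℝ → ℝ} (hu : ContinuousOn u (Set.Icc a b))
    (hua : u a = a) (hub : u b = b) : Continuous (glueFun a b u) := by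
  -- Written with the retraction of the line onto `[a, b]`, the function is visibly continuous.
  have h : glueFun a b u =
      fun x ↦ x + (Set.IccExtend hab ((Set.Icc a b).domRestrict u) x - Set.projIcc a b hab x) := by
    funext x
    rw [glueFun]
    rcases lt_or_ge x a with hx | hx
    · rw [if_neg (fun h ↦ hx.not_ge h.1), Set.IccExtend_of_le_left _ _ hx.le,
        Set.projIcc_of_le_left _ hx.le]
      simp [hua]
    rcases lt_or_ge b x with hx' | hx'
    · rw [if_neg (fun h ↦ hx'.not_ge h.2), Set.IccExtend_of_right_le _ _ hx'.le,
        Set.projIcc_of_right_le _ hx'.le]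
      simp [hub]
    · rw [if_pos ⟨hx, hx'⟩, Set.IccExtend_of_mem _ _ ⟨hx, hx'⟩, Set.projIcc_of_mem _ ⟨hx, hx'⟩]
      simp
  rw [h]
  exact continuous_id.add ((hu.domRestrict.Icc_extend' (h := hab)).sub
    (continuous_subtype_val.comp continuous_projIcc))

theorem glueFun_glueFun {a b : ℝ} {u v : ℝ → ℝ} (hu : Set.MapsTo u (Set.Icc a b) (Set.Icc a b))
    (hvu : ∀ x ∈ Set.Icc a b, v (u x) = x) (x : ℝ) : glueFun a b v (glueFun a b u x) = x := by
  by_cases hx : x ∈ Set.Icc a b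
  · rw [glueFun, glueFun, if_pos hx, if_pos (hu hx), hvu x hx]
  · rw [glueFun, glueFun, if_neg hx, if_neg hx]

open Real in
/-- The homeomorphism which is `x ↦ (2x+1)/(x+1)` between the fixed points `ψ < φ` of this
hyperbolic transformation and the identity elsewhere. -/
def goldenHomeo : ℝ ≃ₜ ℝ where
  toFun := glueFun goldenConj goldenRatio fun x ↦ (2 * x + 1) / (x + 1)
  invFun := glueFun goldenConj goldenRatio fun x ↦ (x - 1) / (2 - x)
  left_inv := by
    refine glueFun_glueFun (fun x hx ↦ ?_) fun x hx ↦ ?_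
    · have h1 : 0 < x + 1 := by linarith [hx.1, neg_one_lt_goldenConj]
      have h2 := goldenConj_sq
      have h3 := goldenRatio_sq
      constructor
      · rw [le_div_iff₀ h1]
        nlinarith [mul_nonneg (sub_nonneg.2 hx.1)
          (by linarith [goldenConj_neg] : (0 : ℝ) ≤ 2 - goldenConj)]
      · rw [div_le_iff₀ h1]
        nlinarith [mul_nonneg (sub_nonneg.2 hx.2)
          (by linarith [goldenRatio_lt_two] : (0 : ℝ) ≤ 2 - goldenRatio)]
    · have h1 : x + 1 ≠ 0 := by linarith [hx.1, neg_one_lt_goldenConj]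
      field_simp
      ring
  right_inv := by
    refine glueFun_glueFun (fun x hx ↦ ?_) fun x hx ↦ ?_
    · have h1 : 0 < 2 - x := by linarith [hx.2, goldenRatio_lt_two]
      have h2 := goldenConj_sq
      have h3 := goldenRatio_sq
      constructor
      · rw [le_div_iff₀ h1]
        nlinarith [mul_nonneg (sub_nonneg.2 hx.1)
          (by linarith [neg_one_lt_goldenConj] : (0 : ℝ) ≤ 1 + goldenConj)]
      · rw [div_le_iff₀ h1]
        nlinarith [mul_nonneg (sub_nonneg.2 hx.2)
          (by linarith [goldenRatio_pos] : (0 : ℝ) ≤ 1 + goldenRatio)]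
    · have h1 : 2 - x ≠ 0 := by linarith [hx.2, goldenRatio_lt_two]
      field_simp
      ring
  continuous_toFun := by
    refine continuous_glueFun (goldenConj_neg.le.trans goldenRatio_pos.le) ?_ ?_ ?_
    · refine ContinuousOn.div (by fun_prop) (by fun_prop) fun x hx ↦ ?_
      linarith [hx.1, neg_one_lt_goldenConj]
    · rw [div_eq_iff (by linarith [neg_one_lt_goldenConj])]
      linarith [goldenConj_sq]
    · rw [div_eq_iff (by linarith [goldenRatio_pos])]
      linarith [goldenRatio_sq]
  continuous_invFun := by
    refine continuous_glueFun (goldenConj_neg.le.trans goldenRatio_pos.le) ?_ ?_ ?_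
    · refine ContinuousOn.div (by fun_prop) (by fun_prop) fun x hx ↦ ?_
      linarith [hx.2, goldenRatio_lt_two]
    · rw [div_eq_iff (by linarith [goldenConj_neg])]
      linarith [goldenConj_sq]
    · rw [div_eq_iff (by linarith [goldenRatio_lt_two])]
      linarith [goldenRatio_sq]

/-- The matrix of `x ↦ (2x+1)/(x+1)`. -/
def goldenMat (A : Type*) [CommRing A] : SpecialLinearGroup (Fin 2) A :=
  ⟨!![2, 1; 1, 1], by rw [det_fin_two]; simp; norm_num⟩

section

variable {A : Subring ℚ}

theorem goldenHomeo_eq_proj {x : ℝ} (hx : x ∈ Set.Icc Real.goldenConj Real.goldenRatio) :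
    ((goldenHomeo x : ℝ) : OnePoint ℝ) = proj ℝ (goldenMat A) x := by
  have h1 : x + 1 ≠ 0 := by linarith [hx.1, Real.neg_one_lt_goldenConj]
  rw [proj_coe]
  simp only [goldenMat, Matrix.of_apply, Matrix.cons_val', Matrix.cons_val_zero,
    Matrix.cons_val_one, Matrix.cons_val_fin_one, map_one, one_mul, map_ofNat]
  rw [if_neg h1]
  congr 1
  exact if_pos hx

theorem goldenHomeo_of_notMem {x : ℝ} (hx : x ∉ Set.Icc Real.goldenConj Real.goldenRatio) :
    goldenHomeo x = x := if_neg hx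

theorem goldenHomeo_of_notMem_Ioo {x : ℝ} (hx : x ∉ Set.Ioo Real.goldenConj Real.goldenRatio) :
    goldenHomeo x = x := by
  by_cases h : x ∈ Set.Icc Real.goldenConj Real.goldenRatio
  · have h2 : (2 * x + 1) / (x + 1) = x := by
      rw [div_eq_iff (by linarith [h.1, Real.neg_one_lt_goldenConj])]
      rcases h.1.eq_or_lt with h1 | h1
      · rw [← h1]; linarith [Real.goldenConj_sq]
      rcases h.2.eq_or_lt with h1 | h1
      · rw [h1]; linarith [Real.goldenRatio_sq]
      · exact absurd ⟨‹_›, h1⟩ hx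
    exact (if_pos h).trans h2
  · exact goldenHomeo_of_notMem h

theorem goldenHomeo_mem_Gam (S : Set ℕ) : goldenHomeo ∈ Gam S := by
  refine ⟨{Real.goldenConj, Real.goldenRatio}, by simp, fun I hI hd ↦ ?_⟩
  rw [Set.disjoint_right] at hd
  have hid : (∀ x ∈ I, x ∉ Set.Ioo Real.goldenConj Real.goldenRatio) →
      ∃ g : SpecialLinearGroup (Fin 2) (ZInv S), ∀ x ∈ I,
        ((goldenHomeo x : ℝ) : OnePoint ℝ) = proj ℝ g x := fun h ↦
    ⟨1, fun x hx ↦ by rw [goldenHomeo_of_notMem_Ioo (h x hx), proj_one]⟩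
  rcases subset_Iic_or_subset_Ici hI (hd (a := Real.goldenConj) (by simp)) with h1 | h1
  · exact hid fun x hx hx' ↦ (h1 hx).not_gt hx'.1
  rcases subset_Iic_or_subset_Ici hI (hd (a := Real.goldenRatio) (by simp)) with h2 | h2
  · exact ⟨goldenMat _, fun x hx ↦ goldenHomeo_eq_proj ⟨h1 hx, h2 hx⟩⟩
  · exact hid fun x hx hx' ↦ (h2 hx).not_gt hx'.2

theorem hasPart_goldenHomeo {x : ℝ} (hx : x ∈ Set.Ioo Real.goldenConj Real.goldenRatio) :
    HasPart goldenHomeo x (goldenMat A) := by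
  rw [HasPart, OnePoint.nhds_coe_eq, eventually_map]
  filter_upwards [isOpen_Ioo.mem_nhds hx] with y hy
  exact goldenHomeo_eq_proj (Set.Ioo_subset_Icc_self hy)

theorem proj_goldenMat_infty {F : Type*} [Field F] [Algebra A F] :
    proj F (goldenMat A) (OnePoint.infty : OnePoint F) = ((2 : F) : OnePoint F) := by
  rw [proj_infty]
  simp [goldenMat, map_ofNat]

end

/-! ### There is no fixed point -/

/-- A fixed point would be almost everywhere the Dirac mass at `∞`, by invariance under
translations, but the matrix carried by `goldenHomeo` on `(ψ, φ)` moves `∞`. -/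
theorem not_exists_fixed (S : Set ℕ) (p : ℕ) [Fact p.Prime] (hp : p ∈ S) :
    ¬ ∃ f : K p, ∀ h : Gam S, h • f = f := by
  rintro ⟨⟨f⟩, hf⟩
  have hf' : ∀ h : Gam S, h • K.mk f = K.mk f := hf
  have h0 := ae_range_coe_eq_zero hp hf'
  have h1 := ext_preserves_null (goldenHomeo_mem_Gam S) h0
  have h2 := ae_eq_actFun_of_smul_eq hf' (goldenHomeo_mem_Gam S)
  have hd := Measure.dense_of_ae (ae_lebesgue_iff.1 (h0.and (h1.and h2)))
  obtain ⟨x, hx, hx0, hx1, hx2⟩ := hd.inter_open_nonempty _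
    (isOpen_Ioo (a := Real.goldenConj) (b := Real.goldenRatio))
    (Set.nonempty_Ioo.2 (Real.goldenConj_neg.trans Real.goldenRatio_pos))
  obtain ⟨y, rfl⟩ := goldenHomeo.surjective x
  have hy : y ∈ Set.Ioo Real.goldenConj Real.goldenRatio := by
    by_contra h
    rw [goldenHomeo_of_notMem_Ioo h] at hx
    exact h hx
  have hsymm : (extP1 goldenHomeo).symm (goldenHomeo y : ℝ) = (y : OnePoint ℝ) :=
    congrArg _ (goldenHomeo.symm_apply_apply y)
  rw [← ext_symm, hsymm] at hx1
  rw [actFun, hsymm, push_part (hasPart_goldenHomeo hy)] at hx2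
  have hm : MeasurableSet (Set.range ((↑) : ℚ_[p] → OnePoint ℚ_[p])) :=
    OnePoint.isOpen_range_coe.measurableSet
  rw [← hx2] at hx0
  have hx0' : (f.1 y : Measure (OnePoint ℚ_[p]))
      (proj ℚ_[p] (goldenMat (ZInv S)) ⁻¹' Set.range ((↑) : ℚ_[p] → OnePoint ℚ_[p])) = 0 :=
    (Measure.map_apply (measurable_proj _) hm).symm.trans hx0
  -- The matrix sends `∞` to `2`, so the preimage of `ℚ_p` contains `∞`.
  have huniv : (f.1 y : Measure (OnePoint ℚ_[p])) Set.univ = 0 := by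
    refine measure_mono_null (fun z _ ↦ ?_) (measure_union_null hx0' hx1)
    induction z using OnePoint.rec with
    | infty => exact Or.inl ⟨2, proj_goldenMat_infty.symm⟩
    | coe z => exact Or.inr ⟨z, rfl⟩
  rw [measure_univ] at huniv
  exact one_ne_zero huniv

/-! ### Breakpoints are fixed points of hyperbolic elements -/

theorem exists_specialLinearGroup {A : Type*} [CommRing A] {a b c d : A} (h : a * d - b * c = 1) :
    ∃ g : SpecialLinearGroup (Fin 2) A, g 0 0 = a ∧ g 0 1 = b ∧ g 1 0 = c ∧ g 1 1 = d :=
  ⟨⟨!![a, b; c, d], by rw [det_fin_two]; exact h⟩, rfl, rfl, rfl, rfl⟩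

theorem infty_mem_hyperbolicFixedPoints {S : Set ℕ} {p : ℕ} (hpp : p.Prime) (hp : p ∈ S) :
    OnePoint.infty ∈ hyperbolicFixedPoints (ZInv S) := by
  have hp2 : (2 : ℚ) ≤ p := by exact_mod_cast hpp.two_le
  let u : ZInv S := ⟨(p : ℚ)⁻¹, Subring.subset_closure ⟨p, hp, rfl⟩⟩
  have hu : (p : ZInv S) * u = 1 := Subtype.ext (by simp [u, hpp.ne_zero])
  obtain ⟨g, h00, -, h10, h11⟩ := exists_specialLinearGroup (a := (p : ZInv S)) (b := 0) (c := 0)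
    (d := u) (by rw [hu, mul_zero, sub_zero])
  refine ⟨g, ?_, ?_⟩
  · have h1 : (0 : ℚ) < (p : ℚ)⁻¹ := by positivity
    have h2 : (p : ℚ) * (p : ℚ)⁻¹ = 1 := mul_inv_cancel₀ (by linarith)
    have h3 : (4 : ℚ) < (p + (p : ℚ)⁻¹) ^ 2 := by nlinarith
    rw [h00, h11]
    simpa [u] using h3
  · rw [proj_infty, h10, map_zero, if_pos rfl]

/-- `SL₂(ℤ)` acts transitively on the rational points of the projective line, so all of these are
hyperbolic fixed points as soon as `∞` is one. -/
theorem ratCast_mem_hyperbolicFixedPoints {A : Subring ℚ}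
    (h : OnePoint.infty ∈ hyperbolicFixedPoints A) (q : ℚ) :
    (((q : ℝ) : OnePoint ℝ)) ∈ hyperbolicFixedPoints A := by
  obtain ⟨u, v, huv⟩ := (Int.isCoprime_iff_gcd_eq_one.2 q.reduced :
    IsCoprime q.num (q.den : ℤ))
  have hdet : (q.num : A) * (u : A) - (-v : A) * ((q.den : ℤ) : A) = 1 := by
    have := congrArg (Int.cast : ℤ → A) huv
    push_cast at this ⊢
    linear_combination this
  obtain ⟨g, h00, -, h10, -⟩ := exists_specialLinearGroup hdet
  have h1 := hyperbolicFixedPoints_invariant A g _ h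
  rw [proj_infty, h00, h10, if_neg (by simp)] at h1
  convert h1 using 2
  simp only [map_intCast, Int.cast_natCast]
  exact (Rat.cast_def q)

/-- An element of `SL₂(A)` with a real fixed point `x` has `trace² ≥ 4`.  When it is not hyperbolic,
either it is central or `x` is the double root of a quadratic polynomial with coefficients in `A`,
hence rational. -/
theorem proj_eq_self_of_notMem {A : Subring ℚ} (h : OnePoint.infty ∈ hyperbolicFixedPoints A)
    (g : SpecialLinearGroup (Fin 2) A) {x : ℝ} (hg : proj ℝ g x = x)
    (hx : (x : OnePoint ℝ) ∉ hyperbolicFixedPoints A) (z : ℝ) : proj ℝ g z = z := by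
  have htr : ((g 0 0 + g 1 1 : A) : ℚ) ^ 2 ≤ 4 := by
    by_contra! h4
    exact hx ⟨g, h4, hg⟩
  have hcoe : ∀ t : A, algebraMap A ℝ t = ((t : ℚ) : ℝ) := fun _ ↦ rfl
  obtain ⟨a, ha⟩ : ∃ a : ℚ, a = (g 0 0 : A) := ⟨_, rfl⟩
  obtain ⟨b, hb⟩ : ∃ b : ℚ, b = (g 0 1 : A) := ⟨_, rfl⟩
  obtain ⟨c, hc⟩ : ∃ c : ℚ, c = (g 1 0 : A) := ⟨_, rfl⟩
  obtain ⟨d, hd⟩ : ∃ d : ℚ, d = (g 1 1 : A) := ⟨_, rfl⟩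
  have hdet : (a * d - b * c : ℝ) = 1 := by
    have := g.det_coe
    rw [det_fin_two] at this
    have h2 : a * d - b * c = 1 := by
      rw [ha, hb, hc, hd]
      exact_mod_cast congrArg (Subtype.val : A → ℚ) this
    exact_mod_cast h2
  have htr' : (a + d : ℝ) ^ 2 ≤ 4 := by
    have : (a + d) ^ 2 ≤ 4 := by rw [ha, hd]; exact_mod_cast htr
    exact_mod_cast this
  rw [proj_coe, hcoe, hcoe, hcoe, hcoe, ← ha, ← hb, ← hc, ← hd] at hg ⊢
  split_ifs at hg with h0
  · exact absurd hg.symm (OnePoint.coe_ne_infty _)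
  rw [OnePoint.coe_eq_coe, div_eq_iff h0] at hg
  -- `x` is a root of `c X² + (d - a) X - b`, whose discriminant is `trace² - 4 ≤ 0`.
  have hsq : (2 * c * x + (d - a) : ℝ) ^ 2 = (a + d) ^ 2 - 4 := by
    linear_combination (-4 * c : ℝ) * hg - 4 * hdet
  have hroot : (2 * c * x + (d - a) : ℝ) = 0 := by
    have : (2 * c * x + (d - a) : ℝ) ^ 2 = 0 := le_antisymm (by linarith) (sq_nonneg _)
    exact pow_eq_zero_iff two_ne_zero |>.1 this
  by_cases hc0 : (c : ℝ) = 0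
  · have hda : (d : ℝ) = a := by rw [hc0] at hroot; linarith
    have hb0 : (b : ℝ) = 0 := by rw [hc0, hda] at hg; linarith
    have ha0 : (a : ℝ) ≠ 0 := by
      intro ha0
      rw [ha0, hc0] at hdet
      simp at hdet
    rw [hc0, hda, hb0, zero_mul, zero_add, add_zero, if_neg ha0, mul_div_cancel_left₀ _ ha0]
  · exfalso
    apply hx
    have hxq : x = ((((a - d) / (2 * c) : ℚ)) : ℝ) := by
      push_cast
      rw [eq_div_iff (mul_ne_zero two_ne_zero hc0)]
      linarith
    rw [hxq]
    exact ratCast_mem_hyperbolicFixedPoints h _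

/-- `h` is given by a single element of `SL₂(A)` on every interval whose interior misses `F`. -/
def IsPiecewiseOff (A : Subring ℚ) (h : ℝ ≃ₜ ℝ) (F : Set ℝ) : Prop :=
  ∀ I : Set ℝ, I.OrdConnected → Disjoint (interior I) F →
    ∃ g : SpecialLinearGroup (Fin 2) A, ∀ x ∈ I, ((h x : ℝ) : OnePoint ℝ) = proj ℝ g x

/-- The two projective parts of `h` at a breakpoint `b` differ by an element of `SL₂(A)` fixing
`b`, so they agree when `b` is not a hyperbolic fixed point. -/
theorem IsPiecewiseOff.of_insert {A : Subring ℚ} (hA : OnePoint.infty ∈ hyperbolicFixedPoints A)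
    {h : ℝ ≃ₜ ℝ} {F : Set ℝ} {b : ℝ} (hb : (b : OnePoint ℝ) ∉ hyperbolicFixedPoints A)
    (hF : IsPiecewiseOff A h (insert b F)) : IsPiecewiseOff A h F := by
  intro I hI hd
  by_cases hbI : b ∈ interior I
  · have hbI' := interior_subset hbI
    obtain ⟨g, hg⟩ := hF (I ∩ Set.Iic b) (hI.inter Set.ordConnected_Iic) (by
      rw [interior_inter, interior_Iic, Set.disjoint_left]
      rintro x ⟨hx, hxb⟩ (rfl | hxF)
      · exact lt_irrefl x (hxb : _)
      · exact Set.disjoint_left.1 hd hx hxF)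
    obtain ⟨g', hg'⟩ := hF (I ∩ Set.Ici b) (hI.inter Set.ordConnected_Ici) (by
      rw [interior_inter, interior_Ici, Set.disjoint_left]
      rintro x ⟨hx, hxb⟩ (rfl | hxF)
      · exact lt_irrefl x (hxb : _)
      · exact Set.disjoint_left.1 hd hx hxF)
    have hfix : proj ℝ (g⁻¹ * g') b = b := by
      rw [proj_mul, ← hg' b ⟨hbI', le_refl b⟩, hg b ⟨hbI', le_refl b⟩, proj_inv_proj]
    have hgg' : ∀ z : ℝ, proj ℝ g' z = proj ℝ g z := fun z ↦ by
      have h1 := proj_eq_self_of_notMem hA _ hfix hb z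
      rw [proj_mul] at h1
      rw [← proj_proj_inv g (proj ℝ g' z), h1]
    refine ⟨g, fun x hx ↦ ?_⟩
    rcases le_total x b with hxb | hxb
    · exact hg x ⟨hx, hxb⟩
    · rw [hg' x ⟨hx, hxb⟩, hgg']
  · refine hF I hI (Set.disjoint_right.2 ?_)
    rintro x (rfl | hxF)
    · exact hbI
    · exact Set.disjoint_right.1 hd hxF

theorem IsPiecewise.of_univ {A : Subring ℚ} (hA : OnePoint.infty ∈ hyperbolicFixedPoints A)
    {h : ℝ ≃ₜ ℝ} (hh : IsPiecewise A Set.univ h) : IsPiecewise A (hyperbolicFixedPoints A) h := by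
  classical
  obtain ⟨F₀, -, hF₀⟩ := hh
  -- The points of `F` are treated one by one: kept in `G` if hyperbolic, discarded otherwise.
  have key : ∀ F G : Finset ℝ, (∀ b ∈ G, (b : OnePoint ℝ) ∈ hyperbolicFixedPoints A) →
      IsPiecewiseOff A h (F ∪ G : Finset ℝ) → IsPiecewise A (hyperbolicFixedPoints A) h := by
    intro F
    induction F using Finset.induction_on with
    | empty => exact fun G hG hFG ↦ ⟨G, hG, by rwa [Finset.empty_union] at hFG⟩
    | insert b F hbF ih =>
      intro G hG hFG
      by_cases hb : (b : OnePoint ℝ) ∈ hyperbolicFixedPoints A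
      · refine ih (insert b G) (fun x hx ↦ ?_) (by rwa [Finset.union_insert, ← Finset.insert_union])
        rcases Finset.mem_insert.1 hx with rfl | hx
        · exact hb
        · exact hG x hx
      · refine ih G hG (IsPiecewiseOff.of_insert hA hb ?_)
        rwa [← Finset.coe_insert, ← Finset.insert_union]
  exact key F₀ ∅ (by simp) (by simpa using! hF₀)

theorem Gam_eq_H {S : Set ℕ} {p : ℕ} (hpp : p.Prime) (hp : p ∈ S) : Gam S = H (ZInv S) := by
  ext h
  exact ⟨IsPiecewise.of_univ (infty_mem_hyperbolicFixedPoints hpp hp),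
    fun ⟨F, _, hF⟩ ↦ ⟨F, fun _ _ ↦ Set.mem_univ _, hF⟩⟩

/-! ### Non-amenability -/

instance (p : ℕ) [Fact p.Prime] : Nonempty (K p) :=
  ⟨K.mk ⟨fun _ ↦ ⟨Measure.dirac OnePoint.infty, inferInstance⟩, measurable_const⟩⟩

theorem not_isAmenable_Gam {S : Set ℕ} {p : ℕ} [Fact p.Prime] (hp : p ∈ S) :
    ¬ IsAmenable (Gam S) := fun h ↦
  not_exists_fixed S p hp (h _ (K p) (K.pairing p) inferInstance (isConvexCompactSpace_pairing S))

end PiecewiseProjective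

end

open PiecewiseProjective in
theorem mainTheorem2 (S : Set ℕ) (hS : ∀ q ∈ S, q.Prime) (p : ℕ) [Fact p.Prime] (hp : p ∈ S) :
    Gam S = H (ZInv S) ∧
    IsConvexCompactSpace (Gam S) (K.pairing p) ∧
    (¬ ∃ f : K p, ∀ h : Gam S, h • f = f) ∧
    ¬ IsAmenable (Gam S) :=
  ⟨Gam_eq_H Fact.out hp, isConvexCompactSpace_pairing S, not_exists_fixed S p hp,
    not_isAmenable_Gam hp⟩
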